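/- Let $A,B,C\in\mathbb R$, $\sigma_1,\sigma_2>0$, $\delta\in(-1,1)$ and $q>0$. For each sample size $n$ let the mediation model $$M=ZA+E_1,\qquad R=ZC+MB+E_2$$ hold, where $Z,M,R,E_1,E_2$ are vectors of length $n$, the error vector satisfies $$\operatorname{vec}\big[(E_1\ E_2)\big]\sim\mathcal N(0,\Sigma\otimes I_n),\qquad \Sigma=\begin{pmatrix}\sigma_1^2&\delta\sigma_1\sigma_2\\ \delta\sigma_1\sigma_2&\sigma_2^2\end{pmatrix},$$ and the treatment vector $Z$ is independent of the errors (in particular $Z$ may be deterministic). Consider the estimators, for known $\sigma_1,\sigma_2,\delta$, $$\hat A=\frac{Z^\top M}{Z^\top Z},\qquad \hat C=\frac{M^\top M\,Z^\top R-Z^\top M\,M^\top R}{Z^\top Z\,M^\top M-M^\top Z\,Z^\top M}+\frac{\delta\sigma_2\,Z^\top M}{\sigma_1\,Z^\top Z},$$ $$\hat B=\frac{Z^\top Z\,M^\top R-M^\top Z\,Z^\top R}{Z^\top Z\,M^\top M-M^\top Z\,Z^\top M}-\frac{\delta\sigma_2}{\sigma_1}.$$ If $Z^\top Z/n\to q$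 in probability as $n\to\infty$, then $$\sqrt n\left(\begin{pmatrix}\hat A\\ \hat C\\ \hat B\end{pmatrix}-\begin{pmatrix}A\\ C\\ B\end{pmatrix}\right)\xrightarrow{\ \mathcal D\ }\mathcal N(0,V),$$ where $V$ is the positive definite matrix $$V=\begin{pmatrix}\dfrac{\sigma_1^2}{q}&\dfrac{\delta\sigma_1\sigma_2}{q}&0\\[2mm] \dfrac{\delta\sigma_1\sigma_2}{q}&\dfrac{\sigma_2^2(qA^2+\sigma_1^2-qA^2\delta^2)}{q\sigma_1^2}&-\dfrac{A\sigma_2^2(1-\delta^2)}{\sigma_1^2}\\[2mm] 0&-\dfrac{A\sigma_2^2(1-\delta^2)}{\sigma_1^2}&\dfrac{\sigma_2^2(1-\delta^2)}{\sigma_1^2}\end{pmatrix}.$$ Moreover $V$ is the inverse Fisher information matrix of $(A,C,B)$: if $I_n(z)$ denotes the Fisher information matrix of $(A,C,B)$ (with $\sigma_1,\sigma_2,\delta$ known) contained in $(M,R)$ for the design $Z=z$, then $n^{-1}I_n(Z)\to V^{-1}$ in probability, entry by entry. In this sense the estimator is asymptotically efficient. -/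

import Mathlib

open MeasureTheory ProbabilityTheory Filter Topology
open scoped Matrix Kronecker

namespace Mediation

/-- The `n × 2` matrix `(u v)` with columns `u` and `v`. -/
def colPair {n : ℕ} (u v : Fin n → ℝ) : Matrix (Fin n) (Fin 2) ℝ :=
  Matrix.of fun i => ![u i, v i]

/-- The coefficient matrix with rows `(A, C)` and `(0, B)`; the parameter is `θ = (A, C, B)`. -/
def coefMatrix (θ : Fin 3 → ℝ) : Matrix (Fin 2) (Fin 2) ℝ :=
  !![θ 0, θ 1; 0, θ 2]

/-- The error covariance matrix `Σ` of one unit. -/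
def errorCov (σ₁ σ₂ δ : ℝ) : Matrix (Fin 2) (Fin 2) ℝ :=
  !![σ₁ ^ 2, δ * σ₁ * σ₂; δ * σ₁ * σ₂, σ₂ ^ 2]

/-- The law `N(0, Σ ⊗ Iₙ)` of the stacked error vector `vec (E₁ E₂)`. -/
noncomputable def errorLaw (n : ℕ) (σ₁ σ₂ δ : ℝ) :
    Measure (EuclideanSpace ℝ (Fin 2 × Fin n)) :=
  multivariateGaussian 0 (errorCov σ₁ σ₂ δ ⊗ₖ (1 : Matrix (Fin n) (Fin n) ℝ))

/-- The single level mediation model with `n` units: `(M R) = (Z M) Θ + (E₁ E₂)`, where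
`vec (E₁ E₂) ∼ N(0, Σ ⊗ Iₙ)` and the treatment vector `Z` is independent of the errors (which
is automatic when `Z` is a deterministic design). -/
structure IsModel {Ω : Type*} [MeasurableSpace Ω] (μ : Measure Ω) {n : ℕ}
    (θ : Fin 3 → ℝ) (σ₁ σ₂ δ : ℝ) (Z M R E₁ E₂ : Ω → Fin n → ℝ) : Prop where
  aemeasurable_treatment : AEMeasurable Z μ
  law_error : HasLaw (fun ω => WithLp.toLp 2 (colPair (E₁ ω) (E₂ ω)).vec)
    (errorLaw n σ₁ σ₂ δ) μ
  indep : IndepFun Z (fun ω => (E₁ ω, E₂ ω)) μ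
  equation : ∀ᵐ ω ∂μ, colPair (M ω) (R ω) =
    colPair (Z ω) (M ω) * coefMatrix θ + colPair (E₁ ω) (E₂ ω)

/-- The estimator of `A`. -/
noncomputable def estA {n : ℕ} (z m : Fin n → ℝ) : ℝ :=
  (z ⬝ᵥ m) / (z ⬝ᵥ z)

/-- The estimator of `C`. -/
noncomputable def estC {n : ℕ} (σ₁ σ₂ δ : ℝ) (z m r : Fin n → ℝ) : ℝ :=
  ((m ⬝ᵥ m) * (z ⬝ᵥ r) - (z ⬝ᵥ m) * (m ⬝ᵥ r)) /
      ((z ⬝ᵥ z) * (m ⬝ᵥ m) - (m ⬝ᵥ z) * (z ⬝ᵥ m)) +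
    δ * σ₂ * (z ⬝ᵥ m) / (σ₁ * (z ⬝ᵥ z))

/-- The estimator of `B`. -/
noncomputable def estB {n : ℕ} (σ₁ σ₂ δ : ℝ) (z m r : Fin n → ℝ) : ℝ :=
  ((z ⬝ᵥ z) * (m ⬝ᵥ r) - (m ⬝ᵥ z) * (z ⬝ᵥ r)) /
      ((z ⬝ᵥ z) * (m ⬝ᵥ m) - (m ⬝ᵥ z) * (z ⬝ᵥ m)) -
    δ * σ₂ / σ₁

/-- The estimator of `(A, C, B)`. -/
noncomputable def estimator {n : ℕ} (σ₁ σ₂ δ : ℝ) (z m r : Fin n → ℝ) : Fin 3 → ℝ :=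
  ![estA z m, estC σ₁ σ₂ δ z m r, estB σ₁ σ₂ δ z m r]

/-- The likelihood criterion
`ℓ(Θ, Σ) = - n log det Σ - tr ((Y - X Θ) Σ⁻¹ (Y - X Θ)ᵀ)` with `Y = (M R)`, `X = (Z M)`. -/
noncomputable def likelihoodCriterion {n : ℕ} (σ₁ σ₂ δ : ℝ) (z m r : Fin n → ℝ)
    (θ : Fin 3 → ℝ) : ℝ :=
  -(n : ℝ) * Real.log (errorCov σ₁ σ₂ δ).det -
    ((colPair m r - colPair z m * coefMatrix θ) * (errorCov σ₁ σ₂ δ)⁻¹ *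
      (colPair m r - colPair z m * coefMatrix θ)ᵀ).trace

/-- The logarithm of the density of `(M, R)` at `(m, r)` given the design `z`:
half the likelihood criterion, up to the normalizing constant. -/
noncomputable def logDensity {n : ℕ} (σ₁ σ₂ δ : ℝ) (z m r : Fin n → ℝ) (θ : Fin 3 → ℝ) : ℝ :=
  likelihoodCriterion σ₁ σ₂ δ z m r θ / 2 - n * Real.log (2 * Real.pi)

/-- The score: the partial derivatives of the log density in the parameter `θ = (A, C, B)`. -/
noncomputable def score {n : ℕ} (σ₁ σ₂ δ : ℝ) (z m r : Fin n → ℝ) (θ : Fin 3 → ℝ)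
    (i : Fin 3) : ℝ :=
  deriv (fun t => logDensity σ₁ σ₂ δ z m r (Function.update θ i t)) (θ i)

/-- The solution `(M, R)` of the model equations for the design `z` and the stacked error
vector `e`. -/
noncomputable def outcome {n : ℕ} (θ : Fin 3 → ℝ) (z : Fin n → ℝ)
    (e : EuclideanSpace ℝ (Fin 2 × Fin n)) : (Fin n → ℝ) × (Fin n → ℝ) :=
  (fun k => z k * θ 0 + e (0, k),
    fun k => z k * θ 1 + (z k * θ 0 + e (0, k)) * θ 2 + e (1, k))

/-- The law of `(M, R)` for the design `z` and the parameter `θ`. -/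
noncomputable def outcomeLaw {n : ℕ} (θ : Fin 3 → ℝ) (σ₁ σ₂ δ : ℝ) (z : Fin n → ℝ) :
    Measure ((Fin n → ℝ) × (Fin n → ℝ)) :=
  (errorLaw n σ₁ σ₂ δ).map (outcome θ z)

/-- The Fisher information matrix of `θ = (A, C, B)` in the sample `(M, R)`, for the design `z`
(and known `σ₁, σ₂, δ`): the second moment matrix of the score. -/
noncomputable def fisherInformation {n : ℕ} (θ : Fin 3 → ℝ) (σ₁ σ₂ δ : ℝ) (z : Fin n → ℝ) :
    Matrix (Fin 3) (Fin 3) ℝ :=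
  Matrix.of fun i j =>
    ∫ y, score σ₁ σ₂ δ z y.1 y.2 θ i * score σ₁ σ₂ δ z y.1 y.2 θ j
      ∂(outcomeLaw θ σ₁ σ₂ δ z)

/-- The asymptotic covariance matrix of the estimator of `(A, C, B)`. -/
noncomputable def asymptoticCov (A σ₁ σ₂ δ q : ℝ) : Matrix (Fin 3) (Fin 3) ℝ :=
  !![σ₁ ^ 2 / q, δ * σ₁ * σ₂ / q, 0;
     δ * σ₁ * σ₂ / q,
       σ₂ ^ 2 * (q * A ^ 2 + σ₁ ^ 2 - q * A ^ 2 * δ ^ 2) / (q * σ₁ ^ 2),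
       -(A * σ₂ ^ 2 * (1 - δ ^ 2) / σ₁ ^ 2);
     0, -(A * σ₂ ^ 2 * (1 - δ ^ 2) / σ₁ ^ 2), σ₂ ^ 2 * (1 - δ ^ 2) / σ₁ ^ 2]

end Mediation

/-! Whitening reduces everything to two independent standard Gaussian vectors `x`, `y`, independent
of `Z`: with `τ = residualStd σ₂ δ`, `E₁ = σ₁ x` and `E₂ = δ σ₂ x + τ y` (`errorLaw_eq_map`,
`hasLaw_standardized_of_isModel`). Since `δ σ₂ x = (δ σ₂ / σ₁)(M - Z A)`, regressing `R` on `(Z, M)`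
shifts the coefficients of `M` and `Z` by `δ σ₂ / σ₁` and `-A δ σ₂ / σ₁`; the correction terms of
the estimators remove these shifts, with `A` estimated.

Put `u = Z / ‖Z‖`. Outside degenerate events the rescaled estimation error is exactly a continuous
function of `G = (⟪u, x⟫, ⟪u, y⟫, ⟪x, y⟫ / √n)` and of scale factors computed from `(‖Z‖² / n, ‖x‖²
/ n, ⟪u, x⟫ / √n)` (`sqrt_smul_estimator_sub`). The scale statistics tend to `(q, 1, 0)` in
probability. Given `(Z, x)`, the part of `⟪G, t⟫` involving `y` is Gaussian with variance tending to
`t₁² + t₂²`; integrating out `y` and then `x` shows that `G` tends to a standard Gaussian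
(`tendsto_charFun_gaussianStatistic`). Slutsky's theorem then gives a linear image of that Gaussian,
with covariance `V = J Jᵀ` for `J = asymptoticRoot`.

For efficiency, the score at the true parameter is a fixed matrix `S` applied to `(⟪z, x⟫, ⟪z, y⟫,
⟪x, y⟫)`. These statistics are uncorrelated with variances `‖z‖², ‖z‖², n`, so the information is
exactly `S diag(‖z‖², ‖z‖², n) Sᵀ`, while `V⁻¹ = S diag(q, q, 1) Sᵀ`. -/

namespace Mediation

/-! ### Convergence in probability to a constant. -/

section InMeasure

variable {Ω : Type*} [MeasurableSpace Ω] {μ : Measure Ω}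

/-- With neighbourhoods in place of radii, the continuous mapping and product rules below become set
inclusions. -/
lemma tendsto_measure_notMem_of_tendstoInMeasure {E : Type*} [PseudoMetricSpace E]
    {X : ℕ → Ω → E} {c : E} (h : TendstoInMeasure μ X atTop (fun _ => c)) {U : Set E}
    (hU : U ∈ 𝓝 c) : Tendsto (fun n => μ {ω | X n ω ∉ U}) atTop (𝓝 0) := by
  obtain ⟨ε, hε, hεU⟩ := Metric.mem_nhds_iff.1 hU
  refine tendsto_of_tendsto_of_tendsto_of_le_of_le tendsto_const_nhds
    (tendstoInMeasure_iff_dist.1 h ε hε) (fun _ => zero_le) fun n => measure_mono ?_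
  intro ω hω
  by_contra hlt
  exact hω (hεU (by simpa using hlt))

lemma tendstoInMeasure_of_tendsto_measure_notMem {E : Type*} [PseudoMetricSpace E]
    {X : ℕ → Ω → E} {c : E}
    (h : ∀ U ∈ 𝓝 c, Tendsto (fun n => μ {ω | X n ω ∉ U}) atTop (𝓝 0)) :
    TendstoInMeasure μ X atTop (fun _ => c) := by
  refine tendstoInMeasure_iff_dist.2 fun ε hε => ?_
  refine (h _ (Metric.ball_mem_nhds c hε)).congr fun n => ?_
  simp

/-- Convergence in probability to a constant is preserved by maps continuous at the constant. -/
lemma tendstoInMeasure_comp_continuousAt {E F : Type*} [PseudoMetricSpace E]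
    [PseudoMetricSpace F] {X : ℕ → Ω → E} {c : E}
    (h : TendstoInMeasure μ X atTop (fun _ => c)) {g : E → F} (hg : ContinuousAt g c) :
    TendstoInMeasure μ (fun n ω => g (X n ω)) atTop (fun _ => g c) :=
  tendstoInMeasure_of_tendsto_measure_notMem fun _ hU =>
    tendsto_measure_notMem_of_tendstoInMeasure h (hg hU)

lemma tendstoInMeasure_prodMk_const {E F : Type*} [PseudoMetricSpace E] [PseudoMetricSpace F]
    {X : ℕ → Ω → E} {Y : ℕ → Ω → F} {c : E} {d : F}
    (hX : TendstoInMeasure μ X atTop (fun _ => c))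
    (hY : TendstoInMeasure μ Y atTop (fun _ => d)) :
    TendstoInMeasure μ (fun n ω => (X n ω, Y n ω)) atTop (fun _ => (c, d)) := by
  refine tendstoInMeasure_of_tendsto_measure_notMem fun U hU => ?_
  obtain ⟨V, hV, W, hW, hVW⟩ := mem_nhds_prod_iff.1 hU
  have hsum := (tendsto_measure_notMem_of_tendstoInMeasure hX hV).add
    (tendsto_measure_notMem_of_tendstoInMeasure hY hW)
  rw [add_zero] at hsum
  refine tendsto_of_tendsto_of_tendsto_of_le_of_le tendsto_const_nhds hsum
    (fun _ => zero_le) fun n => (measure_mono ?_).trans (measure_union_le _ _)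
  intro ω hω
  by_contra hc
  simp only [Set.mem_union, Set.mem_ofPred_eq, not_or, not_not] at hc
  exact hω (hVW ⟨hc.1, hc.2⟩)

/-- Convergence in probability to a constant only depends on the random variables off events
whose probability tends to `0`. -/
lemma tendstoInMeasure_of_eq_off {E F : Type*} [PseudoMetricSpace E] [PseudoMetricSpace F]
    {X : ℕ → Ω → E} {c : E} (h : TendstoInMeasure μ X atTop (fun _ => c)) {U : Set E}
    (hU : U ∈ 𝓝 c) {Y : ℕ → Ω → F} {d : F}
    (hY : ∀ᶠ n in atTop, ∀ᵐ ω ∂μ, X n ω ∈ U → Y n ω = d) :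
    TendstoInMeasure μ Y atTop (fun _ => d) := by
  refine tendstoInMeasure_of_tendsto_measure_notMem fun V hV => ?_
  refine tendsto_of_tendsto_of_tendsto_of_le_of_le' tendsto_const_nhds
    (tendsto_measure_notMem_of_tendstoInMeasure h hU) (Eventually.of_forall fun _ => zero_le) ?_
  filter_upwards [hY] with n hn
  refine measure_mono_ae ?_
  filter_upwards [hn] with ω hω hωV hωU
  exact hωV (by rw [hω hωU]; exact mem_of_mem_nhds hV)

/-- Bounded convergence for convergence in probability. -/
lemma tendsto_integral_of_tendstoInMeasure_of_bound [IsFiniteMeasure μ] {f : ℕ → Ω → ℂ}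
    {g : Ω → ℂ} {K : ℝ} (hf : ∀ n, AEStronglyMeasurable (f n) μ)
    (hK : ∀ n ω, ‖f n ω‖ ≤ K) (h : TendstoInMeasure μ f atTop g) :
    Tendsto (fun n => ∫ ω, f n ω ∂μ) atTop (𝓝 (∫ ω, g ω ∂μ)) := by
  -- Convergence in measure yields almost everywhere convergence only along a further subsequence,
  -- which suffices for a limit of numbers.
  refine tendsto_of_subseq_tendsto fun ns hns => ?_
  obtain ⟨ms, -, hms⟩ := (h.comp hns).exists_seq_tendsto_ae
  exact ⟨ms, tendsto_integral_of_dominated_convergence (fun _ => K) (fun n => hf _)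
    (integrable_const K) (fun n => ae_of_all _ fun ω => hK _ ω) hms⟩

/-- Markov's inequality for second moments, as a criterion of convergence in probability. -/
lemma tendstoInMeasure_zero_of_integral_sq [IsFiniteMeasure μ] {X : ℕ → Ω → ℝ}
    (hX : ∀ n, MemLp (X n) 2 μ)
    (h : Tendsto (fun n => ∫ ω, X n ω ^ 2 ∂μ) atTop (𝓝 0)) :
    TendstoInMeasure μ X atTop (fun _ => 0) := by
  rw [tendstoInMeasure_iff_measureReal_norm]
  intro ε hε
  have hlim : Tendsto (fun n => (∫ ω, X n ω ^ 2 ∂μ) / ε ^ 2) atTop (𝓝 0) := by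
    simpa using h.div_const (ε ^ 2)
  refine tendsto_of_tendsto_of_tendsto_of_le_of_le tendsto_const_nhds hlim
    (fun _ => measureReal_nonneg) fun n => ?_
  rw [le_div_iff₀ (by positivity), mul_comm]
  refine le_trans ?_ (mul_meas_ge_le_integral_of_nonneg (ae_of_all _ fun ω => sq_nonneg (X n ω))
    (hX n).integrable_sq (ε ^ 2))
  refine mul_le_mul_of_nonneg_left (measureReal_mono ?_) (by positivity)
  intro ω hω
  have : ε ≤ |X n ω| := by simpa using hω
  simpa using pow_le_pow_left₀ hε.le this 2

end InMeasure

/-! ### Moments of standard Gaussian vectors. -/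

section Gaussian

open scoped RealInnerProductSpace

variable {E : Type*} [NormedAddCommGroup E] [InnerProductSpace ℝ E] [FiniteDimensional ℝ E]
  [MeasurableSpace E] [BorelSpace E]

lemma memLp_inner_stdGaussian (u : E) (p : ENNReal) (hp : p ≠ ⊤) :
    MemLp (fun x => ⟪u, x⟫) p (stdGaussian E) :=
  (IsGaussian.memLp_id (stdGaussian E) p hp).continuousLinearMap_comp (innerSL ℝ u)

lemma integral_inner_stdGaussian (u : E) : ∫ x, ⟪u, x⟫ ∂(stdGaussian E) = 0 :=
  integral_strongDual_stdGaussian (innerSL ℝ u)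

lemma integral_inner_mul_inner_stdGaussian (u v : E) :
    ∫ x, ⟪u, x⟫ * ⟪v, x⟫ ∂(stdGaussian E) = ⟪u, v⟫ := by
  have h := covarianceBilin_apply_eq_cov (μ := stdGaussian E)
    (IsGaussian.memLp_id _ 2 (by simp)) u v
  rw [covarianceBilin_stdGaussian, covariance_eq_sub (memLp_inner_stdGaussian u 2 (by simp))
    (memLp_inner_stdGaussian v 2 (by simp))] at h
  rw [integral_inner_stdGaussian, zero_mul, sub_zero] at h
  exact h.symm

lemma integral_cexp_inner_stdGaussian (u : E) :
    ∫ x, Complex.exp (⟪u, x⟫ * Complex.I) ∂(stdGaussian E) =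
      Complex.exp (-(‖u‖ : ℂ) ^ 2 / 2) := by
  rw [← charFun_stdGaussian, charFun_apply]
  simp_rw [real_inner_comm u]

variable {n : ℕ}

lemma dotProduct_self_eq_norm_sq (z : Fin n → ℝ) : z ⬝ᵥ z = ‖WithLp.toLp 2 z‖ ^ 2 := by
  rw [EuclideanSpace.real_norm_sq_eq]
  simp [dotProduct, pow_two]

lemma integral_norm_sq_stdGaussian :
    ∫ x, ‖x‖ ^ 2 ∂(stdGaussian (EuclideanSpace ℝ (Fin n))) = n := by
  have h (i : Fin n) := integral_inner_mul_inner_stdGaussian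
    (EuclideanSpace.basisFun (Fin n) ℝ i) (EuclideanSpace.basisFun (Fin n) ℝ i)
  have hm (i : Fin n) := memLp_inner_stdGaussian (EuclideanSpace.basisFun (Fin n) ℝ i) 2
    (by simp)
  simp only [EuclideanSpace.basisFun_apply, EuclideanSpace.inner_single_left, map_one, one_mul,
    PiLp.single_apply, ite_true] at h hm
  simp_rw [EuclideanSpace.real_norm_sq_eq]
  rw [integral_finsetSum _ fun i _ => (hm i).integrable_sq]
  simp_rw [pow_two, h]
  simp

lemma holderTriple_four_four_two : ENNReal.HolderTriple 4 4 2 := ⟨by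
  rw [← ENNReal.toReal_eq_toReal_iff' (by simp) (by simp)]
  simp [ENNReal.toReal_add]
  norm_num⟩

lemma memLp_sq_gaussianReal : MemLp (fun x : ℝ => x ^ 2) 2 (gaussianReal 0 1) := by
  have h : MemLp (id : ℝ → ℝ) 4 (gaussianReal 0 1) := memLp_id_gaussianReal 4
  have := holderTriple_four_four_two
  simpa [pow_two, Pi.mul_def] using MemLp.mul h h (r := 2)

lemma memLp_norm_sq_stdGaussian :
    MemLp (fun x => ‖x‖ ^ 2) 2 (stdGaussian (EuclideanSpace ℝ (Fin n))) := by
  rw [← map_pi_eq_stdGaussian]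
  refine (memLp_map_measure_iff (by fun_prop) (by fun_prop)).2 ?_
  simp only [Function.comp_def, EuclideanSpace.real_norm_sq_eq]
  exact memLp_finsetSum _ fun i _ =>
    memLp_sq_gaussianReal.comp_measurePreserving (measurePreserving_eval _ i)

/-- Only the linear growth in `n` matters for the law of large numbers, so the one-dimensional
variance is left unevaluated. -/
lemma variance_norm_sq_stdGaussian :
    Var[fun x => ‖x‖ ^ 2; stdGaussian (EuclideanSpace ℝ (Fin n))] =
      n * Var[fun x => x ^ 2; gaussianReal 0 1] := by
  rw [← map_pi_eq_stdGaussian, variance_map (by fun_prop) (by fun_prop)]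
  have : (fun x : EuclideanSpace ℝ (Fin n) => ‖x‖ ^ 2) ∘ WithLp.toLp 2 =
      ∑ i, fun x : Fin n → ℝ => x i ^ 2 := by
    ext x
    simp [EuclideanSpace.real_norm_sq_eq]
  rw [this, variance_sum_pi (X := fun _ x => x ^ 2) fun _ => memLp_sq_gaussianReal]
  simp

end Gaussian

/-! ### Whitening the error vector. -/

section ErrorLaw

open scoped RealInnerProductSpace

variable {n : ℕ} {σ₁ σ₂ δ : ℝ}

/-- The standard deviation of the second error given the first. -/
noncomputable def residualStd (σ₂ δ : ℝ) : ℝ := σ₂ * √(1 - δ ^ 2)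

lemma one_sub_sq_pos (hδ : |δ| < 1) : 0 < 1 - δ ^ 2 :=
  sub_pos.2 ((sq_lt_one_iff_abs_lt_one δ).2 hδ)

lemma residualStd_pos (hσ₂ : 0 < σ₂) (hδ : |δ| < 1) : 0 < residualStd σ₂ δ :=
  mul_pos hσ₂ (Real.sqrt_pos.2 (one_sub_sq_pos hδ))

lemma residualStd_sq (hδ : |δ| < 1) : residualStd σ₂ δ ^ 2 = σ₂ ^ 2 * (1 - δ ^ 2) := by
  rw [residualStd, mul_pow, Real.sq_sqrt (one_sub_sq_pos hδ).le]

/-- The stacked error vector built from two standardized vectors. -/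
noncomputable def mixErrors (n : ℕ) (σ₁ σ₂ δ : ℝ)
    (p : EuclideanSpace ℝ (Fin n) × EuclideanSpace ℝ (Fin n)) :
    EuclideanSpace ℝ (Fin 2 × Fin n) :=
  WithLp.toLp 2 fun i => ![σ₁ * p.1 i.2, δ * σ₂ * p.1 i.2 + residualStd σ₂ δ * p.2 i.2] i.1

lemma mixErrors_zero (p : EuclideanSpace ℝ (Fin n) × EuclideanSpace ℝ (Fin n)) (k : Fin n) :
    mixErrors n σ₁ σ₂ δ p (0, k) = σ₁ * p.1 k := rfl

lemma mixErrors_one (p : EuclideanSpace ℝ (Fin n) × EuclideanSpace ℝ (Fin n)) (k : Fin n) :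
    mixErrors n σ₁ σ₂ δ p (1, k) = δ * σ₂ * p.1 k + residualStd σ₂ δ * p.2 k := rfl

lemma measurable_mixErrors : Measurable (mixErrors n σ₁ σ₂ δ) := by
  refine (WithLp.measurable_toLp 2 _).comp (measurable_pi_lambda _ ?_)
  rintro ⟨i, k⟩
  fin_cases i
  · simp only [Fin.zero_eta, Matrix.cons_val_zero]
    fun_prop
  · simp only [Fin.mk_one, Matrix.cons_val_one]
    fun_prop

lemma posSemidef_errorCov (hδ : |δ| < 1) : (errorCov σ₁ σ₂ δ).PosSemidef := by
  have h : errorCov σ₁ σ₂ δ = !![σ₁, 0; δ * σ₂, residualStd σ₂ δ] *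
      (!![σ₁, 0; δ * σ₂, residualStd σ₂ δ])ᴴ := by
    have := residualStd_sq (σ₂ := σ₂) hδ
    ext i j
    fin_cases i <;> fin_cases j <;>
      simp [errorCov, Matrix.mul_apply, Fin.sum_univ_two] <;> linarith
  rw [h]
  exact Matrix.posSemidef_self_mul_conjTranspose _

/-- The characteristic functions agree: the adjoint of the mixing map sends `t` to the pair `(p,
r)`, and `‖p‖² + ‖r‖²` is the quadratic form of `Σ ⊗ I` at `t`, by the Cholesky factorization of
`Σ`. -/
lemma errorLaw_eq_map (hδ : |δ| < 1) :
    errorLaw n σ₁ σ₂ δ =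
      ((stdGaussian (EuclideanSpace ℝ (Fin n))).prod
        (stdGaussian (EuclideanSpace ℝ (Fin n)))).map (mixErrors n σ₁ σ₂ δ) := by
  have : IsProbabilityMeasure (((stdGaussian (EuclideanSpace ℝ (Fin n))).prod
      (stdGaussian (EuclideanSpace ℝ (Fin n)))).map (mixErrors n σ₁ σ₂ δ)) :=
    Measure.isProbabilityMeasure_map measurable_mixErrors.aemeasurable
  have : IsProbabilityMeasure (errorLaw n σ₁ σ₂ δ) := by
    unfold errorLaw
    infer_instance
  refine Measure.ext_of_charFun (funext fun t => ?_)
  rw [errorLaw, charFun_multivariateGaussian ((posSemidef_errorCov hδ).kronecker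
    Matrix.PosSemidef.one), charFun_apply, integral_map measurable_mixErrors.aemeasurable
    (by fun_prop)]
  set p : EuclideanSpace ℝ (Fin n) :=
    WithLp.toLp 2 fun k => σ₁ * t (0, k) + δ * σ₂ * t (1, k) with hp
  set r : EuclideanSpace ℝ (Fin n) := WithLp.toLp 2 fun k => residualStd σ₂ δ * t (1, k) with hr
  have hinner (x : EuclideanSpace ℝ (Fin n) × EuclideanSpace ℝ (Fin n)) :
      ⟪mixErrors n σ₁ σ₂ δ x, t⟫ = ⟪p, x.1⟫ + ⟪r, x.2⟫ := by
    simp only [PiLp.inner_apply, Fintype.sum_prod_type, Fin.sum_univ_two, mixErrors_zero,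
      mixErrors_one, hp, hr, ← Finset.sum_add_distrib]
    refine Finset.sum_congr rfl fun k _ => ?_
    simp
    ring
  have hquad : t ⬝ᵥ (errorCov σ₁ σ₂ δ ⊗ₖ (1 : Matrix (Fin n) (Fin n) ℝ)) *ᵥ t =
      ‖p‖ ^ 2 + ‖r‖ ^ 2 := by
    simp only [EuclideanSpace.real_norm_sq_eq, hp, hr, mul_pow, residualStd_sq hδ, dotProduct,
      Matrix.mulVec, Fintype.sum_prod_type, Fin.sum_univ_two, Matrix.kroneckerMap_apply,
      Matrix.one_apply, mul_ite, mul_one, mul_zero, ite_mul, zero_mul, Finset.sum_ite_eq,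
      Finset.mem_univ, if_true, ← Finset.sum_add_distrib, errorCov]
    refine Finset.sum_congr rfl fun k _ => ?_
    simp
    ring
  simp_rw [hinner, hquad, Complex.ofReal_add, add_mul, Complex.exp_add]
  rw [integral_prod_mul (fun x => Complex.exp (⟪p, x⟫ * Complex.I))
    (fun x => Complex.exp (⟪r, x⟫ * Complex.I)), integral_cexp_inner_stdGaussian,
    integral_cexp_inner_stdGaussian, ← Complex.exp_add]
  congr 1
  simp
  ring

end ErrorLaw

/-! ### Second moments of the statistics that span the scores. -/

section Fisher

open scoped RealInnerProductSpace

variable {n : ℕ} {σ₁ σ₂ δ : ℝ}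

lemma memLp_inner_fst_snd_stdGaussian :
    MemLp (fun p : EuclideanSpace ℝ (Fin n) × EuclideanSpace ℝ (Fin n) => ⟪p.1, p.2⟫) 2
      ((stdGaussian _).prod (stdGaussian _)) := by
  have hm (k : Fin n) : MemLp (fun x : EuclideanSpace ℝ (Fin n) => x k) 4 (stdGaussian _) := by
    simpa [EuclideanSpace.inner_single_left] using
      memLp_inner_stdGaussian (EuclideanSpace.single k (1 : ℝ)) 4 (by simp)
  have := holderTriple_four_four_two
  simp only [PiLp.inner_apply]
  refine memLp_finsetSum _ fun k _ => ?_
  simpa [Pi.mul_def] using MemLp.mul ((hm k).comp_fst (stdGaussian (EuclideanSpace ℝ (Fin n))))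
    ((hm k).comp_snd (stdGaussian (EuclideanSpace ℝ (Fin n)))) (r := 2)

variable (z : EuclideanSpace ℝ (Fin n))

/-- The three uncorrelated statistics that span the scores. -/
noncomputable def scoreBasis (z : EuclideanSpace ℝ (Fin n))
    (p : EuclideanSpace ℝ (Fin n) × EuclideanSpace ℝ (Fin n)) : Fin 3 → ℝ :=
  ![⟪z, p.1⟫, ⟪z, p.2⟫, ⟪p.1, p.2⟫]

lemma memLp_scoreBasis (i : Fin 3) :
    MemLp (fun p => scoreBasis z p i) 2 ((stdGaussian _).prod (stdGaussian _)) := by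
  have h := memLp_inner_stdGaussian z 2 (by simp)
  fin_cases i
  · exact h.comp_fst _
  · exact h.comp_snd _
  · exact memLp_inner_fst_snd_stdGaussian

/-- By Fubini, one integrates over the second vector with the first fixed; the cross terms vanish by
centring, and `E ‖x‖² = n` gives the last diagonal entry. -/
lemma integral_scoreBasis_mul (i j : Fin 3) :
    ∫ p, scoreBasis z p i * scoreBasis z p j ∂((stdGaussian _).prod (stdGaussian _)) =
      Matrix.diagonal ![‖z‖ ^ 2, ‖z‖ ^ 2, (n : ℝ)] i j := by
  have hint : Integrable (fun p => scoreBasis z p i * scoreBasis z p j)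
      ((stdGaussian _).prod (stdGaussian _)) :=
    (memLp_scoreBasis z i).integrable_mul (memLp_scoreBasis z j)
  rw [integral_prod _ hint]
  have h0 (u : EuclideanSpace ℝ (Fin n)) := integral_inner_stdGaussian u
  have h1 (u v : EuclideanSpace ℝ (Fin n)) := integral_inner_mul_inner_stdGaussian u v
  have h2 := integral_norm_sq_stdGaussian (n := n)
  have h3 (u : EuclideanSpace ℝ (Fin n)) : ∫ x, ⟪x, u⟫ ∂(stdGaussian _) = 0 :=
    (integral_congr_ae (ae_of_all _ fun x => real_inner_comm u x)).trans (h0 u)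
  fin_cases i <;> fin_cases j <;>
    simp [scoreBasis, integral_const_mul, integral_mul_const, h0, h1, h2, h3]

end Fisher

/-! ### The score and the exact Fisher information. -/

section Score

open scoped RealInnerProductSpace

variable {n : ℕ} {σ₁ σ₂ δ : ℝ}

/-- This form splits the quadratic form of `Σ⁻¹` into the square of the first residual and that of
the second given the first. -/
lemma errorCov_inv (hσ₁ : 0 < σ₁) (hσ₂ : 0 < σ₂) (hδ : |δ| < 1) :
    (errorCov σ₁ σ₂ δ)⁻¹ =
      !![1 / σ₁ ^ 2 + (δ * σ₂ / σ₁) ^ 2 / residualStd σ₂ δ ^ 2,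
          -(δ * σ₂ / σ₁) / residualStd σ₂ δ ^ 2;
        -(δ * σ₂ / σ₁) / residualStd σ₂ δ ^ 2, 1 / residualStd σ₂ δ ^ 2] := by
  have h1 := one_sub_sq_pos hδ
  refine Matrix.inv_eq_left_inv ?_
  rw [residualStd_sq hδ]
  ext i j
  fin_cases i <;> fin_cases j <;>
    simp [errorCov, Matrix.mul_apply, Fin.sum_univ_two] <;> field_simp <;> ring

lemma trace_mul_errorCov_inv_mul (hσ₁ : 0 < σ₁) (hσ₂ : 0 < σ₂) (hδ : |δ| < 1)
    (W : Matrix (Fin n) (Fin 2) ℝ) :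
    (W * (errorCov σ₁ σ₂ δ)⁻¹ * Wᵀ).trace =
      ∑ k, ((W k 0 / σ₁) ^ 2 + ((W k 1 - δ * σ₂ / σ₁ * W k 0) / residualStd σ₂ δ) ^ 2) := by
  have h1 := residualStd_pos hσ₂ hδ
  rw [errorCov_inv hσ₁ hσ₂ hδ, Matrix.trace]
  refine Finset.sum_congr rfl fun k _ => ?_
  simp [Matrix.mul_apply, Fin.sum_univ_two]
  field_simp
  ring

/-- The standardized residual of the mediator equation. -/
noncomputable def residualM (σ₁ : ℝ) (z m : Fin n → ℝ) (θ : Fin 3 → ℝ) (k : Fin n) : ℝ :=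
  (m k - z k * θ 0) / σ₁

/-- The standardized residual of the response equation, given the residual of the mediator
equation. -/
noncomputable def residualR (σ₁ σ₂ δ : ℝ) (z m r : Fin n → ℝ) (θ : Fin 3 → ℝ) (k : Fin n) : ℝ :=
  (r k - (z k * θ 1 + m k * θ 2) - δ * σ₂ / σ₁ * (m k - z k * θ 0)) / residualStd σ₂ δ

/-- The log density as a sum of squares of standardized residuals. -/
lemma logDensity_eq (hσ₁ : 0 < σ₁) (hσ₂ : 0 < σ₂) (hδ : |δ| < 1) (z m r : Fin n → ℝ) :
    ∃ c : ℝ, ∀ θ : Fin 3 → ℝ, logDensity σ₁ σ₂ δ z m r θ = c -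
      (∑ k, (residualM σ₁ z m θ k ^ 2 + residualR σ₁ σ₂ δ z m r θ k ^ 2)) / 2 := by
  refine ⟨-(n : ℝ) * Real.log (errorCov σ₁ σ₂ δ).det / 2 - n * Real.log (2 * Real.pi),
    fun θ => ?_⟩
  rw [logDensity, likelihoodCriterion, trace_mul_errorCov_inv_mul hσ₁ hσ₂ hδ]
  simp only [Matrix.sub_apply, Matrix.mul_apply, Fin.sum_univ_two, colPair, coefMatrix,
    Matrix.of_apply, Matrix.cons_val_zero, Matrix.cons_val_one, mul_zero, add_zero,
    Matrix.cons_val', Matrix.cons_val_fin_one, residualM, residualR]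
  ring

lemma hasDerivAt_sub_sum_sq (c t₀ : ℝ) (U V α β : Fin n → ℝ) :
    HasDerivAt (fun t => c -
      (∑ k, ((U k + (t - t₀) * α k) ^ 2 + (V k + (t - t₀) * β k) ^ 2)) / 2)
      (-∑ k, (U k * α k + V k * β k)) t₀ := by
  have h (k : Fin n) : HasDerivAt
      (fun t => (U k + (t - t₀) * α k) ^ 2 + (V k + (t - t₀) * β k) ^ 2)
      (2 * (U k * α k + V k * β k)) t₀ := by
    have hd (u a : ℝ) : HasDerivAt (fun t => (u + (t - t₀) * a) ^ 2) (2 * (u * a)) t₀ := by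
      have := ((((hasDerivAt_id t₀).sub_const t₀).mul_const a).const_add u).fun_pow 2
      simpa [mul_assoc] using this
    rw [mul_add]
    exact (hd (U k) (α k)).add (hd (V k) (β k))
  have hs := ((HasDerivAt.fun_sum fun k (_ : k ∈ Finset.univ) => h k).div_const 2).const_sub c
  rwa [← Finset.mul_sum, mul_div_cancel_left₀ _ (two_ne_zero' ℝ)] at hs

/-- Both residuals are affine in each coordinate of `θ`, with slopes `α`, `β`, so the derivative of
the sum of squares is read off from these slopes. -/
lemma score_eq (hσ₁ : 0 < σ₁) (hσ₂ : 0 < σ₂) (hδ : |δ| < 1) (z m r : Fin n → ℝ)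
    (θ : Fin 3 → ℝ) :
    score σ₁ σ₂ δ z m r θ =
      ![∑ k, z k * (residualM σ₁ z m θ k / σ₁ -
          δ * σ₂ / σ₁ * residualR σ₁ σ₂ δ z m r θ k / residualStd σ₂ δ),
        ∑ k, z k * residualR σ₁ σ₂ δ z m r θ k / residualStd σ₂ δ,
        ∑ k, m k * residualR σ₁ σ₂ δ z m r θ k / residualStd σ₂ δ] := by
  have hτ := residualStd_pos hσ₂ hδ
  obtain ⟨c, hc⟩ := logDensity_eq hσ₁ hσ₂ hδ z m r
  have key (i : Fin 3) (α β : Fin n → ℝ)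
      (h0 : ∀ k t, residualM σ₁ z m (Function.update θ i t) k =
        residualM σ₁ z m θ k + (t - θ i) * α k)
      (h1 : ∀ k t, residualR σ₁ σ₂ δ z m r (Function.update θ i t) k =
        residualR σ₁ σ₂ δ z m r θ k + (t - θ i) * β k) :
      score σ₁ σ₂ δ z m r θ i =
        -∑ k, (residualM σ₁ z m θ k * α k + residualR σ₁ σ₂ δ z m r θ k * β k) := by
    rw [score]
    simp_rw [hc, h0, h1]
    exact (hasDerivAt_sub_sum_sq c (θ i) _ _ α β).deriv
  ext i
  fin_cases i
  · refine (key 0 (fun k => -z k / σ₁) (fun k => δ * σ₂ / σ₁ * z k / residualStd σ₂ δ)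
      (fun k t => ?_) (fun k t => ?_)).trans ?_
    · simp [residualM]
      ring
    · simp [residualR]
      ring
    · simp only [← Finset.sum_neg_distrib, Fin.zero_eta, Matrix.cons_val]
      refine Finset.sum_congr rfl fun k _ => ?_
      ring
  · refine (key 1 0 (fun k => -z k / residualStd σ₂ δ)
      (fun k t => ?_) (fun k t => ?_)).trans ?_
    · simp [residualM]
    · simp [residualR]
      ring
    · simp only [← Finset.sum_neg_distrib, Fin.mk_one, Matrix.cons_val, Pi.zero_apply]
      refine Finset.sum_congr rfl fun k _ => ?_
      ring
  · refine (key 2 0 (fun k => -m k / residualStd σ₂ δ)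
      (fun k t => ?_) (fun k t => ?_)).trans ?_
    · simp [residualM]
    · simp [residualR]
      ring
    · simp only [← Finset.sum_neg_distrib, Fin.reduceFinMk, Matrix.cons_val, Pi.zero_apply]
      refine Finset.sum_congr rfl fun k _ => ?_
      ring

/-- The coefficients of the scores in the statistics `scoreBasis`. -/
noncomputable def scoreMatrix (A σ₁ σ₂ δ : ℝ) : Matrix (Fin 3) (Fin 3) ℝ :=
  !![1 / σ₁, -(δ * σ₂ / σ₁) / residualStd σ₂ δ, 0;
     0, 1 / residualStd σ₂ δ, 0;
     0, A / residualStd σ₂ δ, σ₁ / residualStd σ₂ δ]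

/-- At the true parameter the standardized residuals are the white vectors `p.1` and `p.2`
themselves. -/
lemma score_outcome_mixErrors (hσ₁ : 0 < σ₁) (hσ₂ : 0 < σ₂) (hδ : |δ| < 1) (θ : Fin 3 → ℝ)
    (z : Fin n → ℝ) (p : EuclideanSpace ℝ (Fin n) × EuclideanSpace ℝ (Fin n)) :
    score σ₁ σ₂ δ z (outcome θ z (mixErrors n σ₁ σ₂ δ p)).1
      (outcome θ z (mixErrors n σ₁ σ₂ δ p)).2 θ =
      scoreMatrix (θ 0) σ₁ σ₂ δ *ᵥ scoreBasis (WithLp.toLp 2 z) p := by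
  have hτ := residualStd_pos hσ₂ hδ
  have hM (k : Fin n) :
      residualM σ₁ z (outcome θ z (mixErrors n σ₁ σ₂ δ p)).1 θ k = p.1 k := by
    simp only [residualM, outcome, mixErrors_zero]
    field_simp
    ring
  have hR (k : Fin n) :
      residualR σ₁ σ₂ δ z (outcome θ z (mixErrors n σ₁ σ₂ δ p)).1
        (outcome θ z (mixErrors n σ₁ σ₂ δ p)).2 θ k = p.2 k := by
    simp only [residualR, outcome, mixErrors_zero, mixErrors_one]
    field_simp
    ring
  rw [score_eq hσ₁ hσ₂ hδ]
  simp only [hM, hR]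
  ext i
  fin_cases i <;>
    simp only [scoreMatrix, scoreBasis, Matrix.mulVec, dotProduct, Fin.sum_univ_three,
      PiLp.inner_apply, Fin.zero_eta, Fin.mk_one, Fin.reduceFinMk, Matrix.of_apply,
      Matrix.cons_val, Finset.mul_sum, ← Finset.sum_add_distrib] <;>
    refine Finset.sum_congr rfl fun k _ => ?_ <;>
    simp [outcome, mixErrors_zero] <;> ring

lemma measurable_outcome (θ : Fin 3 → ℝ) (z : Fin n → ℝ) : Measurable (outcome θ z) := by
  unfold outcome
  fun_prop

lemma measurable_score (hσ₁ : 0 < σ₁) (hσ₂ : 0 < σ₂) (hδ : |δ| < 1) (θ : Fin 3 → ℝ)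
    (z : Fin n → ℝ) (i : Fin 3) :
    Measurable fun y : (Fin n → ℝ) × (Fin n → ℝ) => score σ₁ σ₂ δ z y.1 y.2 θ i := by
  simp_rw [score_eq hσ₁ hσ₂ hδ, residualM, residualR]
  fin_cases i <;> simp only [Fin.zero_eta, Fin.mk_one, Fin.reduceFinMk, Matrix.cons_val] <;>
    fun_prop

lemma fisherInformation_eq (hσ₁ : 0 < σ₁) (hσ₂ : 0 < σ₂) (hδ : |δ| < 1) (θ : Fin 3 → ℝ)
    (z : Fin n → ℝ) :
    fisherInformation θ σ₁ σ₂ δ z =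
      scoreMatrix (θ 0) σ₁ σ₂ δ * Matrix.diagonal ![z ⬝ᵥ z, z ⬝ᵥ z, (n : ℝ)] *
        (scoreMatrix (θ 0) σ₁ σ₂ δ)ᵀ := by
  rw [dotProduct_self_eq_norm_sq]
  ext i j
  simp only [fisherInformation, Matrix.of_apply]
  have hmeas := (measurable_score hσ₁ hσ₂ hδ θ z i).fun_mul
    (measurable_score hσ₁ hσ₂ hδ θ z j)
  rw [outcomeLaw, errorLaw_eq_map hδ, Measure.map_map (measurable_outcome θ z)
    measurable_mixErrors, integral_map
    ((measurable_outcome θ z).comp measurable_mixErrors).aemeasurable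
    hmeas.aestronglyMeasurable]
  simp only [Function.comp_apply, score_outcome_mixErrors hσ₁ hσ₂ hδ, Matrix.mulVec, dotProduct,
    Finset.sum_mul_sum]
  have hint (a b : Fin 3) : Integrable (fun p => scoreMatrix (θ 0) σ₁ σ₂ δ i a *
      scoreBasis (WithLp.toLp 2 z) p a * (scoreMatrix (θ 0) σ₁ σ₂ δ j b *
      scoreBasis (WithLp.toLp 2 z) p b)) ((stdGaussian _).prod (stdGaussian _)) :=
    ((memLp_scoreBasis (WithLp.toLp 2 z) a).const_mul _).integrable_mul
      ((memLp_scoreBasis (WithLp.toLp 2 z) b).const_mul _)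
  rw [integral_finsetSum _ fun a _ => integrable_finsetSum _ fun b _ => hint a b]
  simp_rw [integral_finsetSum _ fun b _ => hint _ b, mul_mul_mul_comm, integral_const_mul,
    integral_scoreBasis_mul, Matrix.mul_apply, Finset.sum_mul, Matrix.transpose_apply]
  rw [Finset.sum_comm]
  refine Finset.sum_congr rfl fun b _ => Finset.sum_congr rfl fun a _ => ?_
  ring

end Score

/-! ### The asymptotic covariance, its square root and its inverse. -/

section AsymptoticCov

variable {A σ₁ σ₂ δ q : ℝ}

/-- A square root of the asymptotic covariance matrix. -/
noncomputable def asymptoticRoot (A σ₁ σ₂ δ q : ℝ) : Matrix (Fin 3) (Fin 3) ℝ :=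
  !![σ₁ / √q, 0, 0;
     δ * σ₂ / √q, residualStd σ₂ δ / √q, -(A * (residualStd σ₂ δ / σ₁));
     0, 0, residualStd σ₂ δ / σ₁]

lemma asymptoticCov_eq (hσ₁ : 0 < σ₁) (hδ : |δ| < 1) (hq : 0 < q) :
    asymptoticCov A σ₁ σ₂ δ q =
      asymptoticRoot A σ₁ σ₂ δ q * (asymptoticRoot A σ₁ σ₂ δ q)ᵀ := by
  have hτ := residualStd_sq (σ₂ := σ₂) hδ
  have hs := Real.sq_sqrt hq.le
  have hs0 := Real.sqrt_pos.2 hq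
  ext i j
  fin_cases i <;> fin_cases j <;>
    simp [asymptoticCov, asymptoticRoot, Matrix.mul_apply, Fin.sum_univ_three] <;>
    field_simp <;> simp only [hs, hτ] <;> ring

lemma posDef_asymptoticCov (hσ₁ : 0 < σ₁) (hσ₂ : 0 < σ₂) (hδ : |δ| < 1) (hq : 0 < q) :
    (asymptoticCov A σ₁ σ₂ δ q).PosDef := by
  have hτ := residualStd_pos hσ₂ hδ
  have hs0 := Real.sqrt_pos.2 hq
  rw [asymptoticCov_eq hσ₁ hδ hq, ← Matrix.conjTranspose_eq_transpose_of_trivial]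
  refine Matrix.PosDef.mul_conjTranspose_self _ (Matrix.vecMul_injective_of_isUnit ?_)
  rw [Matrix.isUnit_iff_isUnit_det, isUnit_iff_ne_zero]
  simp [asymptoticRoot, Matrix.det_fin_three, hσ₁.ne', hτ.ne', hs0.ne']

/-- This matches the exact information with `z ⬝ᵥ z / n` replaced by its limit `q`, so convergence
of the information becomes continuity in one real variable. -/
lemma asymptoticCov_inv (hσ₁ : 0 < σ₁) (hσ₂ : 0 < σ₂) (hδ : |δ| < 1) (hq : 0 < q) :
    (asymptoticCov A σ₁ σ₂ δ q)⁻¹ =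
      scoreMatrix A σ₁ σ₂ δ * Matrix.diagonal ![q, q, 1] * (scoreMatrix A σ₁ σ₂ δ)ᵀ := by
  have hτ := residualStd_pos hσ₂ hδ
  have h1 := one_sub_sq_pos hδ
  have hτ2 := residualStd_sq (σ₂ := σ₂) hδ
  refine Matrix.inv_eq_left_inv ?_
  ext i j
  simp only [Matrix.mul_apply, Fin.sum_univ_three, Matrix.transpose_apply, Matrix.diagonal_apply]
  fin_cases i <;> fin_cases j <;> simp [asymptoticCov, scoreMatrix] <;> field_simp <;>
    (try simp only [hτ2]) <;> ring

/-- The information per observation converges to the inverse asymptotic covariance matrix. -/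
lemma tendstoInMeasure_fisherInformation {Ω : Type*} [MeasurableSpace Ω] {μ : Measure Ω}
    (hσ₁ : 0 < σ₁) (hσ₂ : 0 < σ₂) (hδ : |δ| < 1) (hq : 0 < q) {θ : Fin 3 → ℝ}
    {Z : (n : ℕ) → Ω → Fin n → ℝ}
    (hZ : TendstoInMeasure μ (fun (n : ℕ) ω => (Z n ω ⬝ᵥ Z n ω) / (n : ℝ)) atTop
      (fun _ => q)) (i j : Fin 3) :
    TendstoInMeasure μ (fun (n : ℕ) ω => fisherInformation θ σ₁ σ₂ δ (Z n ω) i j / (n : ℝ))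
      atTop (fun _ => (asymptoticCov (θ 0) σ₁ σ₂ δ q)⁻¹ i j) := by
  rw [asymptoticCov_inv hσ₁ hσ₂ hδ hq]
  have hcont : Continuous fun x : ℝ => (scoreMatrix (θ 0) σ₁ σ₂ δ *
      Matrix.diagonal ![x, x, 1] * (scoreMatrix (θ 0) σ₁ σ₂ δ)ᵀ) i j := by
    simp only [Matrix.mul_apply, Matrix.diagonal_apply, Fin.sum_univ_three]
    simp
    fun_prop
  refine (tendstoInMeasure_comp_continuousAt hZ hcont.continuousAt).congr' ?_ EventuallyEq.rfl
  filter_upwards [eventually_ne_atTop 0] with n hn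
  refine ae_of_all _ fun ω => ?_
  have hn' : (n : ℝ) ≠ 0 := by exact_mod_cast hn
  simp only [fisherInformation_eq hσ₁ hσ₂ hδ, Matrix.mul_apply, Fin.sum_univ_three,
    Matrix.diagonal_apply]
  simp
  field_simp

end AsymptoticCov

/-! ### Limits of the scale statistics and of the Gaussian statistics. -/

section Limits

open scoped RealInnerProductSpace

variable {Ω : Type*} [MeasurableSpace Ω] {μ : Measure Ω}

/-- Integrating out a standard Gaussian vector that is independent of `U`. -/
lemma integral_cexp_add_inner_of_hasLaw_prod {β E : Type*} [MeasurableSpace β]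
    [NormedAddCommGroup E] [InnerProductSpace ℝ E] [FiniteDimensional ℝ E] [MeasurableSpace E]
    [BorelSpace E] {ν : Measure β} [IsProbabilityMeasure ν] {U : Ω → β} {Y : Ω → E}
    (h : HasLaw (fun ω => (U ω, Y ω)) (ν.prod (stdGaussian E)) μ) {a : β → ℝ} {b : β → E}
    (ha : Measurable a) (hb : Measurable b) :
    ∫ ω, Complex.exp (((a (U ω) + ⟪b (U ω), Y ω⟫ : ℝ) : ℂ) * Complex.I) ∂μ =
      ∫ ω, Complex.exp (a (U ω) * Complex.I) * Complex.exp (-(‖b (U ω)‖ : ℂ) ^ 2 / 2) ∂μ := by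
  have hm1 : Measurable fun p : β × E =>
      Complex.exp (((a p.1 + ⟪b p.1, p.2⟫ : ℝ) : ℂ) * Complex.I) := by fun_prop
  have hm2 : Measurable fun p : β × E =>
      Complex.exp (a p.1 * Complex.I) * Complex.exp (-(‖b p.1‖ : ℂ) ^ 2 / 2) := by fun_prop
  have e1 := h.integral_comp hm1.aestronglyMeasurable
  have e2 := h.integral_comp hm2.aestronglyMeasurable
  simp only [Function.comp_def] at e1 e2
  rw [e1, e2, integral_prod, integral_prod]
  · refine integral_congr_ae (ae_of_all _ fun x => ?_)
    simp only [Complex.ofReal_add, add_mul, Complex.exp_add, integral_const_mul,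
      integral_cexp_inner_stdGaussian, integral_const, probReal_univ, one_smul]
  · refine Integrable.of_bound hm2.aestronglyMeasurable 1 (ae_of_all _ fun p => ?_)
    rw [norm_mul, Complex.norm_exp_ofReal_mul_I, one_mul, Complex.norm_exp]
    norm_cast
    exact Real.exp_le_one_iff.2 (by have := sq_nonneg ‖b p.1‖; linarith)
  · exact Integrable.of_bound hm1.aestronglyMeasurable 1 (ae_of_all _ fun p => by
      rw [Complex.norm_exp_ofReal_mul_I])

lemma norm_cexp_neg_sq_div_two_le (x : ℝ) : ‖Complex.exp (-(x : ℂ) ^ 2 / 2)‖ ≤ 1 := by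
  rw [Complex.norm_exp]
  norm_cast
  exact Real.exp_le_one_iff.2 (by have := sq_nonneg x; linarith)

variable [IsProbabilityMeasure μ]

/-- The vector `Z` scaled to norm one (or zero). -/
noncomputable def direction {n : ℕ} (z : EuclideanSpace ℝ (Fin n)) : EuclideanSpace ℝ (Fin n) :=
  ‖z‖⁻¹ • z

@[fun_prop]
lemma measurable_direction {n : ℕ} : Measurable (direction (n := n)) := by
  unfold direction
  fun_prop

/-- The value `0` comes from `‖0‖⁻¹ = 0`; a treatment vector may vanish with positive probability
for each `n`. -/
lemma norm_direction_sq {n : ℕ} (z : EuclideanSpace ℝ (Fin n)) :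
    ‖direction z‖ ^ 2 = if ‖z‖ ^ 2 = 0 then 0 else 1 := by
  split_ifs with h
  · have : z = 0 := by simpa using h
    simp [direction, this]
  · have : ‖z‖ ≠ 0 := fun h0 => h (by simp [h0])
    rw [direction, norm_smul, norm_inv, norm_norm, inv_mul_cancel₀ this, one_pow]

variable {Z X Y : (n : ℕ) → Ω → EuclideanSpace ℝ (Fin n)}

/-- The law of large numbers for the squared norms of standard Gaussian vectors. -/
lemma tendstoInMeasure_norm_sq_div (hX : ∀ n, HasLaw (X n) (stdGaussian _) μ) :
    TendstoInMeasure μ (fun (n : ℕ) ω => ‖X n ω‖ ^ 2 / (n : ℝ)) atTop (fun _ => 1) := by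
  have hmem (n : ℕ) : MemLp (fun ω => ‖X n ω‖ ^ 2) 2 μ := by
    have h := memLp_norm_sq_stdGaussian (n := n)
    rw [← (hX n).map_eq, memLp_map_measure_iff (by fun_prop) (hX n).aemeasurable] at h
    exact h
  have hsq : ∀ᶠ n : ℕ in atTop, ∫ ω, (‖X n ω‖ ^ 2 / (n : ℝ) - 1) ^ 2 ∂μ =
      Var[fun x => x ^ 2; gaussianReal 0 1] / n := by
    filter_upwards [eventually_ne_atTop 0] with n hn
    have hn' : (n : ℝ) ≠ 0 := by exact_mod_cast hn
    have h1 : Measurable fun x : EuclideanSpace ℝ (Fin n) => (‖x‖ ^ 2 / (n : ℝ) - 1) ^ 2 := by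
      fun_prop
    have h2 := (hX n).integral_comp h1.aestronglyMeasurable
    have hv := variance_norm_sq_stdGaussian (n := n)
    rw [variance_eq_integral (by fun_prop), integral_norm_sq_stdGaussian] at hv
    simp only [Function.comp_def] at h2
    rw [h2]
    calc _ = ∫ x : EuclideanSpace ℝ (Fin n), (‖x‖ ^ 2 - n) ^ 2 * ((n : ℝ) ^ 2)⁻¹
          ∂(stdGaussian _) := by
          refine integral_congr_ae (ae_of_all _ fun x => ?_)
          field_simp
      _ = _ := by
          rw [integral_mul_const, hv]
          field_simp
  have h0 : TendstoInMeasure μ (fun (n : ℕ) ω => ‖X n ω‖ ^ 2 / (n : ℝ) - 1) atTop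
      (fun _ => 0) := by
    refine tendstoInMeasure_zero_of_integral_sq (fun n => ?_) ?_
    · exact ((hmem n).mul_const (n : ℝ)⁻¹).sub (memLp_const 1)
    · exact (tendsto_const_div_atTop_nhds_zero_nat _).congr' (hsq.mono fun _ h => h.symm)
  simpa using tendstoInMeasure_comp_continuousAt h0
    (g := fun x : ℝ => x + 1) (by fun_prop)

/-- The component of a standard Gaussian vector along an independent direction is bounded in
probability. -/
lemma tendstoInMeasure_inner_direction_div
    (hZX : ∀ n, HasLaw (fun ω => (Z n ω, X n ω)) ((μ.map (Z n)).prod (stdGaussian _)) μ)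
    (hZ : ∀ n, AEMeasurable (Z n) μ) :
    TendstoInMeasure μ (fun (n : ℕ) ω => ⟪direction (Z n ω), X n ω⟫ / √(n : ℝ)) atTop
      (fun _ => 0) := by
  have hprob (n : ℕ) : IsProbabilityMeasure (μ.map (Z n)) :=
    Measure.isProbabilityMeasure_map (hZ n)
  -- Given `Z`, the second moment is `‖u‖² ≤ 1`; division by `√n` brings it below `1 / n`.
  have hle (n : ℕ) (z : EuclideanSpace ℝ (Fin n)) :
      ∫ x, ⟪direction z, x⟫ ^ 2 ∂(stdGaussian _) = ‖direction z‖ ^ 2 := by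
    simp_rw [pow_two, integral_inner_mul_inner_stdGaussian, real_inner_self_eq_norm_mul_norm]
  have hle1 (n : ℕ) (z : EuclideanSpace ℝ (Fin n)) : ‖direction z‖ ^ 2 ≤ 1 := by
    rw [norm_direction_sq]
    split_ifs <;> norm_num
  have hbd (n : ℕ) : Integrable (fun z => ‖direction z‖ ^ 2) (μ.map (Z n)) :=
    Integrable.of_bound (by fun_prop) 1 (ae_of_all _ fun z => by
      rw [Real.norm_of_nonneg (by positivity)]
      exact hle1 n z)
  have hint (n : ℕ) : Integrable (fun p : EuclideanSpace ℝ (Fin n) × EuclideanSpace ℝ (Fin n) =>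
      ⟪direction p.1, p.2⟫ ^ 2) ((μ.map (Z n)).prod (stdGaussian _)) := by
    refine (integrable_prod_iff (by fun_prop)).2 ⟨ae_of_all _ fun z =>
      (memLp_inner_stdGaussian (direction z) 2 (by simp)).integrable_sq, ?_⟩
    simp only [norm_pow, Real.norm_eq_abs, sq_abs, hle]
    exact hbd n
  have hmem (n : ℕ) : MemLp (fun ω => ⟪direction (Z n ω), X n ω⟫) 2 μ := by
    have h := (memLp_two_iff_integrable_sq (f := fun p : EuclideanSpace ℝ (Fin n) ×
      EuclideanSpace ℝ (Fin n) => ⟪direction p.1, p.2⟫) (by fun_prop)).2 (hint n)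
    rw [← (hZX n).map_eq, memLp_map_measure_iff (by fun_prop) (hZX n).aemeasurable] at h
    exact h
  refine tendstoInMeasure_zero_of_integral_sq (fun n => (hmem n).mul_const (√(n : ℝ))⁻¹) ?_
  refine tendsto_of_tendsto_of_tendsto_of_le_of_le tendsto_const_nhds
    (tendsto_const_div_atTop_nhds_zero_nat 1) (fun n => integral_nonneg fun _ => sq_nonneg _)
    fun n => ?_
  simp only [div_pow, Real.sq_sqrt (Nat.cast_nonneg n), integral_div]
  gcongr
  have h := (hZX n).integral_comp (hint n).aestronglyMeasurable
  simp only [Function.comp_def] at h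
  rw [h, integral_prod _ (hint n)]
  simp only [hle]
  refine (integral_mono (hbd n) (integrable_const 1) (hle1 n)).trans ?_
  simp

/-- The statistics that converge in probability. -/
noncomputable def stochasticScale (n : ℕ) (z x : EuclideanSpace ℝ (Fin n)) : ℝ × ℝ × ℝ :=
  (‖z‖ ^ 2 / n, ‖x‖ ^ 2 / n, ⟪direction z, x⟫ / √(n : ℝ))

/-- The statistics that converge in distribution to a standard Gaussian vector. -/
noncomputable def gaussianStatistic (n : ℕ) (z x y : EuclideanSpace ℝ (Fin n)) :
    EuclideanSpace ℝ (Fin 3) :=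
  !₂[⟪direction z, x⟫, ⟪direction z, y⟫, ⟪x, y⟫ / √(n : ℝ)]

lemma measurable_stochasticScale (n : ℕ) : Measurable fun p : EuclideanSpace ℝ (Fin n) ×
    EuclideanSpace ℝ (Fin n) => stochasticScale n p.1 p.2 := by
  unfold stochasticScale
  fun_prop

lemma measurable_gaussianStatistic (n : ℕ) : Measurable fun p : (EuclideanSpace ℝ (Fin n) ×
    EuclideanSpace ℝ (Fin n)) × EuclideanSpace ℝ (Fin n) =>
      gaussianStatistic n p.1.1 p.1.2 p.2 := by
  unfold gaussianStatistic
  refine (WithLp.measurable_toLp 2 _).comp (measurable_pi_lambda _ fun i => ?_)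
  fin_cases i <;> simp only [Fin.zero_eta, Fin.mk_one, Fin.reduceFinMk, Matrix.cons_val] <;>
    fun_prop

variable {q : ℝ}

lemma tendstoInMeasure_stochasticScale
    (hZX : ∀ n, HasLaw (fun ω => (Z n ω, X n ω)) ((μ.map (Z n)).prod (stdGaussian _)) μ)
    (hZ : ∀ n, AEMeasurable (Z n) μ)
    (hq : TendstoInMeasure μ (fun (n : ℕ) ω => ‖Z n ω‖ ^ 2 / (n : ℝ)) atTop (fun _ => q)) :
    TendstoInMeasure μ (fun n ω => stochasticScale n (Z n ω) (X n ω)) atTop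
      (fun _ => (q, 1, 0)) := by
  have hprob (n : ℕ) : IsProbabilityMeasure (μ.map (Z n)) :=
    Measure.isProbabilityMeasure_map (hZ n)
  exact tendstoInMeasure_prodMk_const hq (tendstoInMeasure_prodMk_const
    (tendstoInMeasure_norm_sq_div fun n => measurePreserving_snd.fun_comp_hasLaw (hZX n))
    (tendstoInMeasure_inner_direction_div hZX hZ))

lemma inner_gaussianStatistic (n : ℕ) (z x y : EuclideanSpace ℝ (Fin n))
    (t : EuclideanSpace ℝ (Fin 3)) :
    ⟪gaussianStatistic n z x y, t⟫ = t 0 * ⟪direction z, x⟫ +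
      ⟪t 1 • direction z + (t 2 / √(n : ℝ)) • x, y⟫ := by
  rw [inner_add_left, real_inner_smul_left, real_inner_smul_left, PiLp.inner_apply,
    Fin.sum_univ_three]
  simp [gaussianStatistic]
  ring

lemma norm_sq_conditional (n : ℕ) (z x : EuclideanSpace ℝ (Fin n)) (a b : ℝ) :
    ‖a • direction z + (b / √(n : ℝ)) • x‖ ^ 2 = a ^ 2 * ‖direction z‖ ^ 2 +
      2 * a * b * (⟪direction z, x⟫ / √(n : ℝ)) + b ^ 2 * (‖x‖ ^ 2 / n) := by
  rw [norm_add_sq_real, norm_smul, norm_smul, real_inner_smul_left, real_inner_smul_right,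
    mul_pow, mul_pow, Real.norm_eq_abs, Real.norm_eq_abs, sq_abs, sq_abs, div_pow,
    Real.sq_sqrt (Nat.cast_nonneg n)]
  ring

/-- Conditioning on `(Z, x)` makes even the bilinear statistic `⟪x, y⟫` Gaussian, so no general
central limit theorem is needed: `hfirst` integrates out `y`, and `hsecond` integrates out `x`. -/
lemma tendsto_charFun_gaussianStatistic (hq0 : 0 < q)
    (hlaw : ∀ n, HasLaw (fun ω => ((Z n ω, X n ω), Y n ω))
      (((μ.map (Z n)).prod (stdGaussian _)).prod (stdGaussian _)) μ)
    (hZ : ∀ n, AEMeasurable (Z n) μ)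
    (hq : TendstoInMeasure μ (fun (n : ℕ) ω => ‖Z n ω‖ ^ 2 / (n : ℝ)) atTop (fun _ => q))
    (t : EuclideanSpace ℝ (Fin 3)) :
    Tendsto (fun n => ∫ ω, Complex.exp
      ((⟪gaussianStatistic n (Z n ω) (X n ω) (Y n ω), t⟫ : ℝ) * Complex.I) ∂μ) atTop
      (𝓝 (Complex.exp (-‖t‖ ^ 2 / 2))) := by
  have hprob (n : ℕ) : IsProbabilityMeasure (μ.map (Z n)) :=
    Measure.isProbabilityMeasure_map (hZ n)
  have hZX (n : ℕ) := measurePreserving_fst.fun_comp_hasLaw (hlaw n)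
  have hscale := tendstoInMeasure_stochasticScale hZX hZ hq
  have hX (n : ℕ) : AEMeasurable (X n) μ := (hZX n).aemeasurable.snd
  -- For `n ≠ 0`, `‖u‖²` is this indicator at `‖Z‖² / n`; its only discontinuity is `0`, away from
  -- `q`.
  have hind : (fun x : ℝ => if x = 0 then (0 : ℝ) else 1) =ᶠ[𝓝 q] fun _ => 1 := by
    filter_upwards [isOpen_ne.mem_nhds hq0.ne'] with x hx
    rw [if_neg hx]
  have hindc : ContinuousAt (fun x : ℝ => if x = 0 then (0 : ℝ) else 1) q :=
    continuousAt_const.congr hind.symm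
  have hdir (n : ℕ) (hn : n ≠ 0) (z : EuclideanSpace ℝ (Fin n)) :
      ‖direction z‖ ^ 2 = if ‖z‖ ^ 2 / n = 0 then 0 else 1 := by
    have hn' : (n : ℝ) ≠ 0 := by exact_mod_cast hn
    rw [norm_direction_sq]
    simp [hn']
  set c : ℂ := Complex.exp (-((t 1 ^ 2 + t 2 ^ 2 : ℝ) : ℂ) / 2) with hc
  set b : (n : ℕ) → Ω → EuclideanSpace ℝ (Fin n) := fun n ω =>
    t 1 • direction (Z n ω) + (t 2 / √(n : ℝ)) • X n ω with hb
  have hcond : TendstoInMeasure μ (fun n ω => Complex.exp (-(‖b n ω‖ : ℂ) ^ 2 / 2)) atTop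
      (fun _ => c) := by
    have hcont : ContinuousAt (fun T : ℝ × ℝ × ℝ => Complex.exp (-((t 1 ^ 2 *
        (if T.1 = 0 then 0 else 1) + 2 * t 1 * t 2 * T.2.2 + t 2 ^ 2 * T.2.1 : ℝ) : ℂ) / 2))
        (q, 1, 0) := by
      have h1 : ContinuousAt (fun T : ℝ × ℝ × ℝ => if T.1 = 0 then (0 : ℝ) else 1) (q, 1, 0) :=
        ContinuousAt.comp (x := (q, (1 : ℝ), (0 : ℝ))) (f := Prod.fst)
          (g := fun x : ℝ => if x = 0 then (0 : ℝ) else 1) hindc continuousAt_fst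
      fun_prop
    have h := tendstoInMeasure_comp_continuousAt hscale hcont
    simp only [if_neg hq0.ne', mul_one, mul_zero, add_zero] at h
    refine h.congr' ?_ EventuallyEq.rfl
    filter_upwards [eventually_ne_atTop 0] with n hn
    refine ae_of_all _ fun ω => ?_
    simp only [hb, stochasticScale]
    rw [← Complex.ofReal_pow, norm_sq_conditional, hdir n hn]
    rfl
  have hfirst (n : ℕ) : ∫ ω, Complex.exp
      ((⟪gaussianStatistic n (Z n ω) (X n ω) (Y n ω), t⟫ : ℝ) * Complex.I) ∂μ =
      ∫ ω, Complex.exp ((t 0 * ⟪direction (Z n ω), X n ω⟫ : ℝ) * Complex.I) *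
        Complex.exp (-(‖b n ω‖ : ℂ) ^ 2 / 2) ∂μ := by
    simp_rw [inner_gaussianStatistic]
    exact integral_cexp_add_inner_of_hasLaw_prod (hlaw n)
      (a := fun p => t 0 * ⟪direction p.1, p.2⟫)
      (b := fun p => t 1 • direction p.1 + (t 2 / √(n : ℝ)) • p.2) (by fun_prop) (by fun_prop)
  have hsecond (n : ℕ) : ∫ ω, Complex.exp ((t 0 * ⟪direction (Z n ω), X n ω⟫ : ℝ) * Complex.I) ∂μ
      = ∫ ω, Complex.exp (-(‖t 0 • direction (Z n ω)‖ : ℂ) ^ 2 / 2) ∂μ := by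
    have h := integral_cexp_add_inner_of_hasLaw_prod (hZX n) (a := fun _ => 0)
      (b := fun z => t 0 • direction z) (by fun_prop) (by fun_prop)
    simpa [real_inner_smul_left] using h
  have hlim0 : Tendsto (fun n => ∫ ω,
      Complex.exp ((t 0 * ⟪direction (Z n ω), X n ω⟫ : ℝ) * Complex.I) ∂μ) atTop
      (𝓝 (Complex.exp (-((t 0 ^ 2 : ℝ) : ℂ) / 2))) := by
    simp_rw [hsecond]
    have hcont : ContinuousAt (fun T : ℝ => Complex.exp (-((t 0 ^ 2 *
        (if T = 0 then 0 else 1) : ℝ) : ℂ) / 2)) q := by fun_prop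
    have h := tendstoInMeasure_comp_continuousAt hq hcont
    simp only [if_neg hq0.ne', mul_one] at h
    have h' := tendsto_integral_of_tendstoInMeasure_of_bound (K := 1)
      (f := fun n ω => Complex.exp (-(‖t 0 • direction (Z n ω)‖ : ℂ) ^ 2 / 2))
      (fun n => AEMeasurable.aestronglyMeasurable (by fun_prop))
      (fun n ω => norm_cexp_neg_sq_div_two_le _) (h.congr' ?_ EventuallyEq.rfl)
    · simpa using h'
    · filter_upwards [eventually_ne_atTop 0] with n hn
      refine ae_of_all _ fun ω => ?_
      beta_reduce
      rw [← Complex.ofReal_pow, norm_smul, mul_pow, hdir n hn]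
      simp
  -- The phase factor need not converge in probability, but it has modulus one, so replacing the
  -- second factor by its limit `c` costs a vanishing error.
  have hlim1 : Tendsto (fun n => ∫ ω,
      Complex.exp ((t 0 * ⟪direction (Z n ω), X n ω⟫ : ℝ) * Complex.I) *
        (Complex.exp (-(‖b n ω‖ : ℂ) ^ 2 / 2) - c) ∂μ) atTop (𝓝 0) := by
    have hdiff : TendstoInMeasure μ (fun n ω =>
        Complex.exp ((t 0 * ⟪direction (Z n ω), X n ω⟫ : ℝ) * Complex.I) *
        (Complex.exp (-(‖b n ω‖ : ℂ) ^ 2 / 2) - c)) atTop (fun _ => 0) := by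
      rw [tendstoInMeasure_iff_norm] at hcond ⊢
      simpa only [sub_zero, norm_mul, Complex.norm_exp_ofReal_mul_I, one_mul] using hcond
    have h' := tendsto_integral_of_tendstoInMeasure_of_bound (K := 1 + ‖c‖)
      (fun n => AEMeasurable.aestronglyMeasurable (by fun_prop))
      (fun n ω => ?_) hdiff
    · simpa using h'
    · rw [norm_mul, Complex.norm_exp_ofReal_mul_I, one_mul]
      exact (norm_sub_le _ _).trans (by gcongr; exact norm_cexp_neg_sq_div_two_le _)
  have hsum := hlim1.add (hlim0.mul_const c)
  have hval : 0 + Complex.exp (-((t 0 ^ 2 : ℝ) : ℂ) / 2) * c = Complex.exp (-‖t‖ ^ 2 / 2) := by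
    rw [zero_add, hc, ← Complex.exp_add, ← Complex.ofReal_pow, EuclideanSpace.real_norm_sq_eq,
      Fin.sum_univ_three]
    congr 1
    push_cast
    ring
  rw [hval] at hsum
  refine hsum.congr fun n => ?_
  rw [hfirst, ← integral_mul_const, ← integral_add]
  · refine integral_congr_ae (ae_of_all _ fun ω => ?_)
    ring
  · refine Integrable.of_bound (AEMeasurable.aestronglyMeasurable (by fun_prop)) (1 + ‖c‖)
      (ae_of_all _ fun ω => ?_)
    rw [norm_mul, Complex.norm_exp_ofReal_mul_I, one_mul]
    exact (norm_sub_le _ _).trans (by gcongr; exact norm_cexp_neg_sq_div_two_le _)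
  · refine Integrable.of_bound (AEMeasurable.aestronglyMeasurable (by fun_prop)) ‖c‖
      (ae_of_all _ fun ω => ?_)
    rw [norm_mul, Complex.norm_exp_ofReal_mul_I, one_mul]

lemma tendstoInDistribution_gaussianStatistic (hq0 : 0 < q)
    (hlaw : ∀ n, HasLaw (fun ω => ((Z n ω, X n ω), Y n ω))
      (((μ.map (Z n)).prod (stdGaussian _)).prod (stdGaussian _)) μ)
    (hZ : ∀ n, AEMeasurable (Z n) μ)
    (hq : TendstoInMeasure μ (fun (n : ℕ) ω => ‖Z n ω‖ ^ 2 / (n : ℝ)) atTop (fun _ => q)) :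
    TendstoInDistribution (fun n ω => gaussianStatistic n (Z n ω) (X n ω) (Y n ω)) atTop
      (id : EuclideanSpace ℝ (Fin 3) → _) (fun _ => μ) (stdGaussian _) := by
  have hm (n : ℕ) : AEMeasurable (fun ω => gaussianStatistic n (Z n ω) (X n ω) (Y n ω)) μ :=
    Measurable.comp_aemeasurable (f := fun ω => ((Z n ω, X n ω), Y n ω))
      (measurable_gaussianStatistic n) (hlaw n).aemeasurable
  refine ⟨hm, aemeasurable_id, ProbabilityMeasure.tendsto_iff_tendsto_charFun.2 fun t => ?_⟩
  simp only [ProbabilityMeasure.coe_mk, Measure.map_id, charFun_stdGaussian]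
  refine (tendsto_charFun_gaussianStatistic hq0 hlaw hZ hq t).congr fun n => ?_
  rw [charFun_apply, integral_map (hm n) (by fun_prop)]

end Limits

/-! ### Recovering white noise from the errors of the model. -/

section Standardize

variable {n : ℕ} {σ₁ σ₂ δ : ℝ}

/-- The standardized independent errors recovered from the errors of the model. -/
noncomputable def standardizeErrors (σ₁ σ₂ δ : ℝ) (e : (Fin n → ℝ) × (Fin n → ℝ)) :
    EuclideanSpace ℝ (Fin n) × EuclideanSpace ℝ (Fin n) :=
  (WithLp.toLp 2 fun k => e.1 k / σ₁,
    WithLp.toLp 2 fun k => (e.2 k - δ * σ₂ / σ₁ * e.1 k) / residualStd σ₂ δ)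

lemma measurable_standardizeErrors : Measurable (standardizeErrors (n := n) σ₁ σ₂ δ) := by
  unfold standardizeErrors
  fun_prop

variable {Ω : Type*} [MeasurableSpace Ω] {μ : Measure Ω}

lemma hasLaw_standardizeErrors (hσ₁ : 0 < σ₁) (hσ₂ : 0 < σ₂) (hδ : |δ| < 1)
    {E₁ E₂ : Ω → Fin n → ℝ}
    (h : HasLaw (fun ω => WithLp.toLp 2 (colPair (E₁ ω) (E₂ ω)).vec) (errorLaw n σ₁ σ₂ δ) μ) :
    HasLaw (fun ω => standardizeErrors σ₁ σ₂ δ (E₁ ω, E₂ ω))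
      ((stdGaussian _).prod (stdGaussian _)) μ := by
  have hτ := residualStd_pos hσ₂ hδ
  set unstack : EuclideanSpace ℝ (Fin 2 × Fin n) → (Fin n → ℝ) × (Fin n → ℝ) :=
    fun e => (fun k => e (0, k), fun k => e (1, k)) with hun
  have hunm : Measurable unstack := by fun_prop
  have hlaw : HasLaw (fun e => standardizeErrors σ₁ σ₂ δ (unstack e))
      ((stdGaussian _).prod (stdGaussian _)) (errorLaw n σ₁ σ₂ δ) := by
    refine ⟨(measurable_standardizeErrors.comp hunm).aemeasurable, ?_⟩
    change Measure.map (standardizeErrors σ₁ σ₂ δ ∘ unstack) _ = _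
    rw [errorLaw_eq_map hδ, Measure.map_map (measurable_standardizeErrors.comp hunm)
      measurable_mixErrors]
    convert! Measure.map_id
    ext p k
    · simp [standardizeErrors, hun, mixErrors_zero, hσ₁.ne']
    · simp only [standardizeErrors, hun, Function.comp_apply, mixErrors_zero, mixErrors_one, id_eq]
      field_simp
      ring
  exact hlaw.fun_comp h

lemma hasLaw_standardized_of_isModel [IsProbabilityMeasure μ] (hσ₁ : 0 < σ₁) (hσ₂ : 0 < σ₂)
    (hδ : |δ| < 1) {θ : Fin 3 → ℝ} {Z M R E₁ E₂ : Ω → Fin n → ℝ}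
    (h : IsModel μ θ σ₁ σ₂ δ Z M R E₁ E₂) :
    HasLaw (fun ω => ((WithLp.toLp 2 (Z ω), (standardizeErrors σ₁ σ₂ δ (E₁ ω, E₂ ω)).1),
        (standardizeErrors σ₁ σ₂ δ (E₁ ω, E₂ ω)).2))
      (((μ.map fun ω => WithLp.toLp 2 (Z ω)).prod (stdGaussian _)).prod (stdGaussian _)) μ := by
  have hlaw := hasLaw_standardizeErrors hσ₁ hσ₂ hδ h.law_error
  have hZ : AEMeasurable (fun ω => WithLp.toLp 2 (Z ω)) μ :=
    (WithLp.measurable_toLp 2 _).comp_aemeasurable h.aemeasurable_treatment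
  have hind : IndepFun (fun ω => WithLp.toLp 2 (Z ω))
      (fun ω => standardizeErrors σ₁ σ₂ δ (E₁ ω, E₂ ω)) μ :=
    h.indep.comp (WithLp.measurable_toLp 2 _) (measurable_standardizeErrors (σ₁ := σ₁))
  have hprob : IsProbabilityMeasure (μ.map fun ω => WithLp.toLp 2 (Z ω)) :=
    Measure.isProbabilityMeasure_map hZ
  have hjoint : HasLaw (fun ω => (WithLp.toLp 2 (Z ω),
      standardizeErrors σ₁ σ₂ δ (E₁ ω, E₂ ω))) ((μ.map fun ω => WithLp.toLp 2 (Z ω)).prod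
        ((stdGaussian _).prod (stdGaussian _))) μ := by
    refine ⟨hZ.prodMk hlaw.aemeasurable, ?_⟩
    rw [(indepFun_iff_map_prod_eq_prod_map_map hZ hlaw.aemeasurable).1 hind, hlaw.map_eq]
  -- Rebracketing isolates the second white vector as the one integrated out given the other two.
  exact ((measurePreserving_prodAssoc _ _ _).symm MeasurableEquiv.prodAssoc).fun_comp_hasLaw hjoint

end Standardize

/-! ### The estimation error as a function of the statistics. -/

section Limit

open scoped RealInnerProductSpace

/-- Characteristic functions agree because `⟪J x, t⟫ = ⟪Jᵀ t, x⟫` and `‖Jᵀ t‖² = t ⬝ᵥ (J Jᵀ) t`. -/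
lemma map_mulVec_stdGaussian {m : ℕ} (J : Matrix (Fin m) (Fin m) ℝ) :
    (stdGaussian (EuclideanSpace ℝ (Fin m))).map (fun x : EuclideanSpace ℝ (Fin m) => WithLp.toLp 2 (J *ᵥ x)) =
      multivariateGaussian 0 (J * Jᵀ) := by
  have hm : Measurable fun x : EuclideanSpace ℝ (Fin m) => WithLp.toLp 2 (J *ᵥ x) := by
    unfold Matrix.mulVec dotProduct
    fun_prop
  have : IsProbabilityMeasure ((stdGaussian (EuclideanSpace ℝ (Fin m))).map
      (fun x : EuclideanSpace ℝ (Fin m) => WithLp.toLp 2 (J *ᵥ x))) := Measure.isProbabilityMeasure_map hm.aemeasurable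
  have hJ : (J * Jᵀ).PosSemidef := by
    simpa using Matrix.posSemidef_self_mul_conjTranspose J
  refine Measure.ext_of_charFun (funext fun t => ?_)
  have hadj (x : EuclideanSpace ℝ (Fin m)) :
      ⟪WithLp.toLp 2 (J *ᵥ x), t⟫ = ⟪WithLp.toLp 2 (Jᵀ *ᵥ t), x⟫ := by
    simp only [EuclideanSpace.inner_eq_star_dotProduct, star_trivial]
    rw [Matrix.dotProduct_mulVec, Matrix.mulVec_transpose, dotProduct_comm]
  rw [charFun_multivariateGaussian hJ, charFun_apply, integral_map hm.aemeasurable (by fun_prop)]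
  simp_rw [hadj]
  rw [integral_cexp_inner_stdGaussian, ← Complex.ofReal_pow, EuclideanSpace.real_norm_sq_eq]
  have hq : t ⬝ᵥ (J * Jᵀ) *ᵥ t = ∑ i, (Jᵀ *ᵥ t) i ^ 2 := by
    rw [← Matrix.mulVec_mulVec, Matrix.dotProduct_mulVec, ← Matrix.mulVec_transpose]
    simp [dotProduct, pow_two]
  rw [hq]
  congr 1
  simp
  ring

/-- The rescaled estimation error as a function of the statistics that converge. -/
noncomputable def errorMap (A σ₁ σ₂ δ : ℝ) (p : EuclideanSpace ℝ (Fin 3) × ℝ × ℝ × ℝ) :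
    EuclideanSpace ℝ (Fin 3) :=
  !₂[σ₁ * p.1 0 * p.2.1,
    residualStd σ₂ δ * p.1 1 * p.2.1 + δ * σ₂ * p.1 0 * p.2.1 -
      (A + σ₁ * p.2.2.2 * p.2.1) *
        (residualStd σ₂ δ / σ₁ * (p.1 2 - p.2.2.2 * p.1 1) * p.2.2.1),
    residualStd σ₂ δ / σ₁ * (p.1 2 - p.2.2.2 * p.1 1) * p.2.2.1]

lemma continuous_errorMap (A σ₁ σ₂ δ : ℝ) : Continuous (errorMap A σ₁ σ₂ δ) := by
  unfold errorMap
  refine (PiLp.continuous_toLp 2 _).comp (continuous_pi fun i => ?_)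
  fin_cases i <;> simp only [Fin.zero_eta, Fin.mk_one, Fin.reduceFinMk, Matrix.cons_val] <;>
    fun_prop

lemma errorMap_limit (A σ₁ σ₂ δ q : ℝ) (x : EuclideanSpace ℝ (Fin 3)) :
    errorMap A σ₁ σ₂ δ (x, 1 / √q, 1, 0) = WithLp.toLp 2 (asymptoticRoot A σ₁ σ₂ δ q *ᵥ x) := by
  ext i
  fin_cases i <;>
    simp [errorMap, asymptoticRoot, Matrix.mulVec, dotProduct, Fin.sum_univ_three] <;> ring

/-- The random scale factors of the estimation error. -/
noncomputable def scaleMap (T : ℝ × ℝ × ℝ) : ℝ × ℝ × ℝ :=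
  (1 / √T.1, 1 / (T.2.1 - T.2.2 ^ 2), T.2.2)

/-- The estimation error expressed through the standardized errors. -/
lemma sqrt_smul_estimator_sub {n : ℕ} {A C B σ₁ σ₂ δ : ℝ} (hσ₁ : 0 < σ₁) (hσ₂ : 0 < σ₂)
    (hδ : |δ| < 1) {z m r : Fin n → ℝ} {x y : EuclideanSpace ℝ (Fin n)}
    (hm : ∀ k, m k = z k * A + σ₁ * x k)
    (hr : ∀ k, r k = z k * C + m k * B + (δ * σ₂ * x k + residualStd σ₂ δ * y k))
    (h1 : (stochasticScale n (WithLp.toLp 2 z) x).1 ≠ 0)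
    (h2 : (stochasticScale n (WithLp.toLp 2 z) x).2.1 -
      (stochasticScale n (WithLp.toLp 2 z) x).2.2 ^ 2 ≠ 0) :
    WithLp.toLp 2 (√(n : ℝ) • (estimator σ₁ σ₂ δ z m r - ![A, C, B])) =
      errorMap A σ₁ σ₂ δ (gaussianStatistic n (WithLp.toLp 2 z) x y,
        scaleMap (stochasticScale n (WithLp.toLp 2 z) x)) := by
  set Z : EuclideanSpace ℝ (Fin n) := WithLp.toLp 2 z with hZ
  have hn : (0 : ℝ) < n := by
    refine lt_of_le_of_ne (Nat.cast_nonneg n) fun h0 => h1 ?_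
    simp [stochasticScale, ← h0]
  have hZ0 : 0 < ‖Z‖ := by
    refine lt_of_le_of_ne (norm_nonneg _) fun h0 => h1 ?_
    simp [stochasticScale, ← h0]
  have hτ := residualStd_pos hσ₂ hδ
  -- With `n = a²` all identities below are between rational functions.
  obtain ⟨a, ha0, ha⟩ : ∃ a : ℝ, 0 < a ∧ √(n : ℝ) = a := ⟨_, Real.sqrt_pos.2 hn, rfl⟩
  have hna : (n : ℝ) = a ^ 2 := by rw [← ha, Real.sq_sqrt hn.le]
  have hsa : √(a ^ 2) = a := Real.sqrt_sq ha0.le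
  have hzz : z ⬝ᵥ z = ‖Z‖ ^ 2 := dotProduct_self_eq_norm_sq z
  have hzm : z ⬝ᵥ m = ‖Z‖ ^ 2 * A + σ₁ * ⟪Z, x⟫ := by
    rw [← hzz, PiLp.inner_apply, dotProduct, dotProduct, Finset.sum_mul, Finset.mul_sum,
      ← Finset.sum_add_distrib]
    refine Finset.sum_congr rfl fun k _ => ?_
    simp [hm, hZ]
    ring
  have hmm : m ⬝ᵥ m = ‖Z‖ ^ 2 * A ^ 2 + 2 * A * σ₁ * ⟪Z, x⟫ + σ₁ ^ 2 * ‖x‖ ^ 2 := by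
    rw [← hzz, EuclideanSpace.real_norm_sq_eq, PiLp.inner_apply, dotProduct, dotProduct,
      Finset.sum_mul, Finset.mul_sum, Finset.mul_sum, ← Finset.sum_add_distrib,
      ← Finset.sum_add_distrib]
    refine Finset.sum_congr rfl fun k _ => ?_
    simp [hm, hZ]
    ring
  have hzr : z ⬝ᵥ r = (z ⬝ᵥ z) * C + (z ⬝ᵥ m) * B + δ * σ₂ * ⟪Z, x⟫ +
      residualStd σ₂ δ * ⟪Z, y⟫ := by
    rw [PiLp.inner_apply, PiLp.inner_apply, dotProduct, dotProduct, dotProduct,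
      Finset.sum_mul, Finset.sum_mul, Finset.mul_sum, Finset.mul_sum, ← Finset.sum_add_distrib,
      ← Finset.sum_add_distrib, ← Finset.sum_add_distrib]
    refine Finset.sum_congr rfl fun k _ => ?_
    simp [hr, hZ]
    ring
  have hmr : m ⬝ᵥ r = (z ⬝ᵥ m) * C + (m ⬝ᵥ m) * B +
      δ * σ₂ * (A * ⟪Z, x⟫ + σ₁ * ‖x‖ ^ 2) +
      residualStd σ₂ δ * (A * ⟪Z, y⟫ + σ₁ * ⟪x, y⟫) := by
    rw [EuclideanSpace.real_norm_sq_eq, PiLp.inner_apply, PiLp.inner_apply, PiLp.inner_apply,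
      dotProduct, dotProduct, dotProduct]
    simp only [Finset.sum_mul, Finset.mul_sum, ← Finset.sum_add_distrib]
    refine Finset.sum_congr rfl fun k _ => ?_
    simp only [hr, hZ, RCLike.inner_apply, conj_trivial]
    linear_combination (δ * σ₂ * x k + residualStd σ₂ δ * y k) * hm k
  have hmz : m ⬝ᵥ z = z ⬝ᵥ m := dotProduct_comm m z
  have hsq : √(‖Z‖ ^ 2 / a ^ 2) = ‖Z‖ / a := by
    rw [← div_pow, Real.sqrt_sq (by positivity)]
  have hdir (v : EuclideanSpace ℝ (Fin n)) : ⟪direction Z, v⟫ = ⟪Z, v⟫ / ‖Z‖ := by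
    rw [direction, real_inner_smul_left, div_eq_inv_mul]
  simp only [stochasticScale, hdir, hna, hsa] at h2
  -- The Gram determinant of `Z` and `x`. Adding the multiple `A Z` to `σ₁ x` does not change it
  -- beyond the factor `σ₁²`, which gives the common denominator of the estimators.
  have hD : ‖Z‖ ^ 2 * ‖x‖ ^ 2 - ⟪Z, x⟫ ^ 2 ≠ 0 := by
    intro h0
    apply h2
    field_simp
    linarith
  have hD2 : (z ⬝ᵥ z) * (m ⬝ᵥ m) - (z ⬝ᵥ m) * (z ⬝ᵥ m) =
      σ₁ ^ 2 * (‖Z‖ ^ 2 * ‖x‖ ^ 2 - ⟪Z, x⟫ ^ 2) := by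
    rw [hmm, hzm, hzz]
    ring
  have hT : ‖x‖ ^ 2 / a ^ 2 - (⟪Z, x⟫ / ‖Z‖ / a) ^ 2 =
      (‖Z‖ ^ 2 * ‖x‖ ^ 2 - ⟪Z, x⟫ ^ 2) / (a ^ 2 * ‖Z‖ ^ 2) := by
    field_simp
  ext i
  fin_cases i
  · simp [estimator, estA, errorMap, gaussianStatistic, scaleMap, stochasticScale, hdir, hna, hsa,
      hsq, hzm, hzz]
    field_simp
    ring
  · simp [estimator, estC, errorMap, gaussianStatistic, scaleMap, stochasticScale, hdir, hna, hsa,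
      hsq, hmz, hD2, hT]
    simp only [hzr, hmr, hmm, hzm, hzz]
    field_simp
    ring
  · simp [estimator, estB, errorMap, gaussianStatistic, scaleMap, stochasticScale, hdir, hna, hsa,
      hsq, hmz, hD2, hT]
    simp only [hzr, hmr, hmm, hzm, hzz]
    field_simp
    ring

end Limit

/-! ### Measurability and the error identity in the model. -/

section Model

variable {Ω : Type*} [MeasurableSpace Ω] {μ : Measure Ω} {n : ℕ} {A C B σ₁ σ₂ δ : ℝ}
  {Z M R E₁ E₂ : Ω → Fin n → ℝ}

lemma IsModel.ae_eq (h : IsModel μ ![A, C, B] σ₁ σ₂ δ Z M R E₁ E₂) :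
    ∀ᵐ ω ∂μ, (∀ k, M ω k = Z ω k * A + E₁ ω k) ∧
      ∀ k, R ω k = Z ω k * C + M ω k * B + E₂ ω k := by
  filter_upwards [h.equation] with ω hω
  refine ⟨fun k => ?_, fun k => ?_⟩
  · have := congrFun (congrFun hω k) 0
    simpa [colPair, coefMatrix, Matrix.mul_apply, Fin.sum_univ_two] using this
  · have := congrFun (congrFun hω k) 1
    simpa [colPair, coefMatrix, Matrix.mul_apply, Fin.sum_univ_two] using this

lemma IsModel.aemeasurable_errors {θ : Fin 3 → ℝ} (h : IsModel μ θ σ₁ σ₂ δ Z M R E₁ E₂) :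
    AEMeasurable E₁ μ ∧ AEMeasurable E₂ μ := by
  have hc (i : Fin 2) : Measurable fun (e : EuclideanSpace ℝ (Fin 2 × Fin n)) k => e (i, k) := by
    fun_prop
  exact ⟨(hc 0).comp_aemeasurable h.law_error.aemeasurable,
    (hc 1).comp_aemeasurable h.law_error.aemeasurable⟩

lemma measurable_estimator :
    Measurable fun p : (Fin n → ℝ) × (Fin n → ℝ) × (Fin n → ℝ) =>
      estimator σ₁ σ₂ δ p.1 p.2.1 p.2.2 := by
  refine measurable_pi_lambda _ fun i => ?_
  fin_cases i <;>
    simp only [estimator, estA, estB, estC, dotProduct, Fin.zero_eta, Fin.mk_one,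
      Fin.reduceFinMk, Matrix.cons_val] <;>
    fun_prop

lemma IsModel.aemeasurable_estimator
    (h : IsModel μ ![A, C, B] σ₁ σ₂ δ Z M R E₁ E₂) :
    AEMeasurable (fun ω => estimator σ₁ σ₂ δ (Z ω) (M ω) (R ω)) μ := by
  have hZ := h.aemeasurable_treatment
  obtain ⟨h1, h2⟩ := h.aemeasurable_errors
  have hM : AEMeasurable M μ := by
    refine AEMeasurable.congr (f := fun ω k => Z ω k * A + E₁ ω k) (by fun_prop) ?_
    filter_upwards [h.ae_eq] with ω hω
    exact funext fun k => (hω.1 k).symm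
  have hR : AEMeasurable R μ := by
    refine AEMeasurable.congr (f := fun ω k => Z ω k * C + M ω k * B + E₂ ω k) (by fun_prop) ?_
    filter_upwards [h.ae_eq] with ω hω
    exact funext fun k => (hω.2 k).symm
  exact Measurable.comp_aemeasurable (f := fun ω => (Z ω, M ω, R ω)) measurable_estimator
    (by fun_prop)

lemma IsModel.ae_estimator_sub_eq (hσ₁ : 0 < σ₁) (hσ₂ : 0 < σ₂) (hδ : |δ| < 1)
    (h : IsModel μ ![A, C, B] σ₁ σ₂ δ Z M R E₁ E₂) :
    ∀ᵐ ω ∂μ, ∀ T, T = stochasticScale n (WithLp.toLp 2 (Z ω))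
        (standardizeErrors σ₁ σ₂ δ (E₁ ω, E₂ ω)).1 → T.1 ≠ 0 → T.2.1 - T.2.2 ^ 2 ≠ 0 →
      WithLp.toLp 2 (√(n : ℝ) • (estimator σ₁ σ₂ δ (Z ω) (M ω) (R ω) - ![A, C, B])) =
        errorMap A σ₁ σ₂ δ (gaussianStatistic n (WithLp.toLp 2 (Z ω))
          (standardizeErrors σ₁ σ₂ δ (E₁ ω, E₂ ω)).1
          (standardizeErrors σ₁ σ₂ δ (E₁ ω, E₂ ω)).2, scaleMap T) := by
  have hτ := residualStd_pos hσ₂ hδ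
  filter_upwards [h.ae_eq] with ω hω T hT h1 h2
  subst hT
  refine sqrt_smul_estimator_sub hσ₁ hσ₂ hδ (fun k => ?_) (fun k => ?_) h1 h2
  · rw [hω.1 k]
    simp only [standardizeErrors]
    field_simp
  · rw [hω.2 k]
    simp only [standardizeErrors]
    field_simp
    ring

end Model

/-! ### Asymptotic normality by Slutsky's theorem. -/

lemma continuousAt_scaleMap {q : ℝ} (hq : 0 < q) : ContinuousAt scaleMap (q, 1, 0) := by
  have h1 : ContinuousAt (fun T : ℝ × ℝ × ℝ => 1 / √T.1) (q, 1, 0) :=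
    continuousAt_const.div (by fun_prop) (Real.sqrt_pos.2 hq).ne'
  have h2 : ContinuousAt (fun T : ℝ × ℝ × ℝ => 1 / (T.2.1 - T.2.2 ^ 2)) (q, 1, 0) :=
    continuousAt_const.div (by fun_prop) (by norm_num)
  exact h1.prodMk (h2.prodMk (by fun_prop))

lemma measurable_scaleMap : Measurable scaleMap := by
  unfold scaleMap
  fun_prop

/-- Convergence in distribution sees only the law of the limit, so the limit variable produced by
Slutsky's theorem may be exchanged for the identity under its law. -/
lemma tendstoInDistribution_id_of_hasLaw {ι Ω Ω' E : Type*} [MeasurableSpace Ω]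
    [MeasurableSpace Ω'] {μ : Measure Ω} [IsProbabilityMeasure μ] {μ' : Measure Ω'}
    [IsProbabilityMeasure μ'] [TopologicalSpace E] [MeasurableSpace E] [OpensMeasurableSpace E]
    {ν : Measure E} [IsProbabilityMeasure ν] {X : ι → Ω → E} {l : Filter ι} {W : Ω' → E}
    (h : TendstoInDistribution X l W (fun _ => μ) μ') (hW : HasLaw W ν μ') :
    TendstoInDistribution X l (id : E → E) (fun _ => μ) ν := by
  refine ⟨h.forall_aemeasurable, aemeasurable_id, ?_⟩
  have h' := h.tendsto
  simp only [hW.map_eq] at h'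
  simpa only [Measure.map_id] using h'

/-- Asymptotic normality of the estimator. -/
lemma tendstoInDistribution_estimator {Ω : Type*} [MeasurableSpace Ω] (μ : Measure Ω)
    [IsProbabilityMeasure μ] {A C B σ₁ σ₂ δ q : ℝ} (hσ₁ : 0 < σ₁) (hσ₂ : 0 < σ₂) (hδ : |δ| < 1)
    (hq : 0 < q) {Z M R E₁ E₂ : (n : ℕ) → Ω → Fin n → ℝ}
    (hmodel : ∀ n, IsModel μ ![A, C, B] σ₁ σ₂ δ (Z n) (M n) (R n) (E₁ n) (E₂ n))
    (hZ : TendstoInMeasure μ (fun (n : ℕ) ω => (Z n ω ⬝ᵥ Z n ω) / (n : ℝ)) atTop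
      (fun _ => q)) :
    TendstoInDistribution
      (fun (n : ℕ) ω => WithLp.toLp 2
        (√(n : ℝ) • (estimator σ₁ σ₂ δ (Z n ω) (M n ω) (R n ω) - ![A, C, B])))
      atTop (id : EuclideanSpace ℝ (Fin 3) → EuclideanSpace ℝ (Fin 3)) (fun _ => μ)
      (multivariateGaussian 0 (asymptoticCov A σ₁ σ₂ δ q)) := by
  set Z' : (n : ℕ) → Ω → EuclideanSpace ℝ (Fin n) := fun n ω => WithLp.toLp 2 (Z n ω) with hZ'
  set X : (n : ℕ) → Ω → EuclideanSpace ℝ (Fin n) := fun n ω =>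
    (standardizeErrors σ₁ σ₂ δ (E₁ n ω, E₂ n ω)).1 with hX
  set Y : (n : ℕ) → Ω → EuclideanSpace ℝ (Fin n) := fun n ω =>
    (standardizeErrors σ₁ σ₂ δ (E₁ n ω, E₂ n ω)).2 with hY
  have hlaw (n : ℕ) : HasLaw (fun ω => ((Z' n ω, X n ω), Y n ω))
      (((μ.map (Z' n)).prod (stdGaussian _)).prod (stdGaussian _)) μ :=
    hasLaw_standardized_of_isModel hσ₁ hσ₂ hδ (hmodel n)
  have hZm (n : ℕ) : AEMeasurable (Z' n) μ :=
    (WithLp.measurable_toLp 2 _).comp_aemeasurable (hmodel n).aemeasurable_treatment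
  have hprob (n : ℕ) : IsProbabilityMeasure (μ.map (Z' n)) :=
    Measure.isProbabilityMeasure_map (hZm n)
  have hZX (n : ℕ) : HasLaw (fun ω => (Z' n ω, X n ω))
      ((μ.map (Z' n)).prod (stdGaussian _)) μ :=
    measurePreserving_fst.fun_comp_hasLaw (hlaw n)
  have hnorm : TendstoInMeasure μ (fun (n : ℕ) ω => ‖Z' n ω‖ ^ 2 / (n : ℝ)) atTop
      (fun _ => q) := by
    simpa only [dotProduct_self_eq_norm_sq] using hZ
  have hscale := tendstoInMeasure_stochasticScale hZX hZm hnorm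
  have hscalem (n : ℕ) : AEMeasurable (fun ω => stochasticScale n (Z' n ω) (X n ω)) μ :=
    Measurable.comp_aemeasurable (f := fun ω => (Z' n ω, X n ω)) (measurable_stochasticScale n)
      (hZX n).aemeasurable
  have hslutsky := (tendstoInDistribution_gaussianStatistic hq hlaw hZm
    hnorm).continuous_comp_prodMk_of_tendstoInMeasure_const (continuous_errorMap A σ₁ σ₂ δ)
    (tendstoInMeasure_comp_continuousAt hscale (continuousAt_scaleMap hq))
    (fun n => measurable_scaleMap.comp_aemeasurable (hscalem n))
  have hlim : HasLaw (fun x : EuclideanSpace ℝ (Fin 3) =>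
      errorMap A σ₁ σ₂ δ (id x, scaleMap (q, 1, 0)))
      (multivariateGaussian 0 (asymptoticCov A σ₁ σ₂ δ q)) (stdGaussian _) := by
    refine ⟨hslutsky.aemeasurable_limit, ?_⟩
    rw [asymptoticCov_eq hσ₁ hδ hq, ← map_mulVec_stdGaussian]
    simp only [← errorMap_limit]
    simp [scaleMap]
  refine tendstoInDistribution_of_tendstoInMeasure_sub _ _
    (tendstoInDistribution_id_of_hasLaw hslutsky hlim) ?_ fun n => ?_
  -- On this open set the error identity is exact. Its complement has vanishing probability, so
  -- values of the estimator at zero denominators do not affect the limit.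
  · have hU : {T : ℝ × ℝ × ℝ | T.1 ≠ 0 ∧ T.2.1 - T.2.2 ^ 2 ≠ 0} ∈ 𝓝 (q, (1 : ℝ), (0 : ℝ)) := by
      refine IsOpen.mem_nhds ?_ ⟨hq.ne', by norm_num⟩
      exact (isOpen_ne_fun (by fun_prop) (by fun_prop)).inter
        (isOpen_ne_fun (by fun_prop) (by fun_prop))
    refine tendstoInMeasure_of_eq_off hscale hU (Eventually.of_forall fun n => ?_)
    filter_upwards [(hmodel n).ae_estimator_sub_eq hσ₁ hσ₂ hδ] with ω hω hT
    exact sub_eq_zero.2 (hω _ rfl hT.1 hT.2)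
  · exact (WithLp.measurable_toLp 2 _).comp_aemeasurable
      (((hmodel n).aemeasurable_estimator.sub_const _).const_smul (√(n : ℝ)))

end Mediation

theorem theorem2 {Ω : Type*} [MeasurableSpace Ω] (μ : Measure Ω) [IsProbabilityMeasure μ]
    (A C B σ₁ σ₂ δ q : ℝ) (hσ₁ : 0 < σ₁) (hσ₂ : 0 < σ₂) (hδ : |δ| < 1) (hq : 0 < q)
    (Z M R E₁ E₂ : (n : ℕ) → Ω → Fin n → ℝ)
    (hmodel : ∀ n, Mediation.IsModel μ ![A, C, B] σ₁ σ₂ δ (Z n) (M n) (R n) (E₁ n) (E₂ n))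
    (hZ : TendstoInMeasure μ (fun (n : ℕ) ω => (Z n ω ⬝ᵥ Z n ω) / (n : ℝ)) atTop
      (fun _ => q)) :
    TendstoInDistribution
      (fun (n : ℕ) ω => WithLp.toLp 2
        (√(n : ℝ) • (Mediation.estimator σ₁ σ₂ δ (Z n ω) (M n ω) (R n ω) - ![A, C, B])))
      atTop (id : EuclideanSpace ℝ (Fin 3) → EuclideanSpace ℝ (Fin 3)) (fun _ => μ)
      (multivariateGaussian 0 (Mediation.asymptoticCov A σ₁ σ₂ δ q)) ∧
    (Mediation.asymptoticCov A σ₁ σ₂ δ q).PosDef ∧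
    ∀ i j, TendstoInMeasure μ
      (fun (n : ℕ) ω =>
        Mediation.fisherInformation ![A, C, B] σ₁ σ₂ δ (Z n ω) i j / (n : ℝ))
      atTop (fun _ => (Mediation.asymptoticCov A σ₁ σ₂ δ q)⁻¹ i j) :=
  ⟨Mediation.tendstoInDistribution_estimator μ hσ₁ hσ₂ hδ hq hmodel hZ,
    Mediation.posDef_asymptoticCov hσ₁ hσ₂ hδ hq,
    Mediation.tendstoInMeasure_fisherInformation hσ₁ hσ₂ hδ hq hZ⟩
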